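/- Let $E$ be a finite directed graph with vertex set $E_0$, edge set $E_1$, source map $s$ and range map $r$ (loops and multiple edges allowed). Its graph C*-algebra $C^*(E)$ is the universal C*-algebra generated by mutually orthogonal projections $P_v$ ($v\in E_0$) and partial isometries $S_e$ ($e\in E_1$) with $S_e^*S_e=P_{r(e)}$ for all $e\in E_1$ and $\sum_{s(e)=v}S_eS_e^*=P_v$ for every $v\in E_0$ that emits an edge. The gauge action of $U(1)$ on $C^*(E)$ is given by $P_v\mapsto P_v$, $S_e\mapsto\lambda S_e$. Let $\bar v\in E_0$ emit a loop $\bar e$, and assume that $E$ is $\bar v$-trimmable, i.e. $s^{-1}(\bar v)=\{\bar e\}$, $r^{-1}(\bar v)\setminus\{\bar e\}\neq\emptyset$, and $s^{-1}(v)\setminus r^{-1}(\bar v)\neq\emptyset$ for every $v\in s(r^{-1}(\bar v)\setminus\{\bar e\})$. Let $E'$ be the subgraph of $E$ obtained by removing the loop $\bar e$, and let $E''$ be the subgraph of $E'$ obtained by removing the vertex $\bar v$ and all edges ending in $\bar v$. Let $u$ be the standard unitary generator of $C(S^1)$. Consider the *-homomorphisms $\pi_1\colon C^*(E)\to C^*(E'')$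 and $\pi_2\colon C^*(E')\to C^*(E'')$ that send $P_{\bar v}$ and all $S_e$ with $r(e)=\bar v$ to $0$ and the other generators to the generators with the same name; the gauge coaction $\delta\colon C^*(E'')\to C^*(E'')\otimes C(S^1)$, $\delta(P_v)=P_v\otimes 1$, $\delta(S_e)=S_e\otimes u$; and $f\colon C^*(E)\to C^*(E')\otimes C(S^1)$, $f(P_v)=P_v\otimes 1$, $f(S_{\bar e})=P_{\bar v}\otimes u$, $f(S_e)=S_e\otimes u$ for $e\neq\bar e$. Then $\pi_1$ and $\pi_2$ are the quotient maps by the closed two-sided ideals generated by $P_{\bar v}$ (they are surjective with these ideals as kernels), and $$\begin{array}{ccc} C^*(E) & \xrightarrow{\ f\ } & C^*(E')\otimes C(S^1)\\ {\scriptstyle\pi_1}\downarrow\ & & \ \downarrow{\scriptstyle\pi_2\otimes\mathrm{id}}\\ C^*(E'') & \xrightarrow{\ \delta\ } & C^*(E'')\otimes C(S^1)\end{array}$$ is a pullback diagram of $U(1)$-C*-algebras. That is, all four maps are $U(1)$-equivariant, where $C^*(E)$ and $C^*(E'')$ carry the gauge action and the tensor products carry the standard $U(1)$-action on $C(S^1)$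 ($u\mapsto\lambda u$); the diagram commutes; and $a\mapsto(\pi_1(a),f(a))$ is a bijection of $C^*(E)$ onto $\{(b,c)\in C^*(E'')\oplus (C^*(E')\otimes C(S^1)) : \delta(b)=(\pi_2\otimes\mathrm{id})(c)\}$. -/

import Mathlib

noncomputable section

open scoped ComplexConjugate

/-- The free unital complex `*`-algebra on a type `X` of generators: the free complex algebra on
the symbols `x` and `x*`. -/
def FreeStarAlgebra (X : Type*) : Type _ := FreeAlgebra ℂ (X ⊕ X)

namespace FreeStarAlgebra

variable {X : Type*}

instance : Ring (FreeStarAlgebra X) := inferInstanceAs (Ring (FreeAlgebra ℂ (X ⊕ X)))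
instance : Algebra ℂ (FreeStarAlgebra X) := inferInstanceAs (Algebra ℂ (FreeAlgebra ℂ (X ⊕ X)))

/-- A generator of the free `*`-algebra. -/
def gen (x : X) : FreeStarAlgebra X := FreeAlgebra.ι ℂ (Sum.inl x)

/-- The adjoint of a generator of the free `*`-algebra. -/
def genStar (x : X) : FreeStarAlgebra X := FreeAlgebra.ι ℂ (Sum.inr x)

theorem induction {p : FreeStarAlgebra X → Prop}
    (algebraMap : ∀ c : ℂ, p (algebraMap ℂ (FreeStarAlgebra X) c))
    (gen : ∀ x, p (gen x)) (genStar : ∀ x, p (genStar x))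
    (mul : ∀ a b, p a → p b → p (a * b)) (add : ∀ a b, p a → p b → p (a + b))
    (a : FreeStarAlgebra X) : p a :=
  FreeAlgebra.induction ℂ (X ⊕ X) algebraMap (fun x => Sum.casesOn x gen genStar) mul add a

/-- The conjugate-linear anti-multiplicative extension of `x ↦ x*`, `x* ↦ x`. -/
def conjHom (X : Type*) : FreeStarAlgebra X →+* (FreeStarAlgebra X)ᵐᵒᵖ :=
  letI : Algebra ℂ (FreeStarAlgebra X)ᵐᵒᵖ := Algebra.compHom _ (starRingEnd ℂ)
  (FreeAlgebra.lift ℂ (fun x : X ⊕ X => MulOpposite.op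
    (Sum.elim genStar gen x : FreeStarAlgebra X)) :
      FreeAlgebra ℂ (X ⊕ X) →ₐ[ℂ] (FreeStarAlgebra X)ᵐᵒᵖ).toRingHom

theorem conjHom_gen (x : X) : conjHom X (gen x) = MulOpposite.op (genStar x) :=
  letI : Algebra ℂ (FreeStarAlgebra X)ᵐᵒᵖ := Algebra.compHom _ (starRingEnd ℂ)
  FreeAlgebra.lift_ι_apply _ _

theorem conjHom_genStar (x : X) : conjHom X (genStar x) = MulOpposite.op (gen x) :=
  letI : Algebra ℂ (FreeStarAlgebra X)ᵐᵒᵖ := Algebra.compHom _ (starRingEnd ℂ)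
  FreeAlgebra.lift_ι_apply _ _

theorem conjHom_algebraMap (c : ℂ) :
    conjHom X (algebraMap ℂ _ c) = MulOpposite.op (algebraMap ℂ _ (conj c)) :=
  letI : Algebra ℂ (FreeStarAlgebra X)ᵐᵒᵖ := Algebra.compHom _ (starRingEnd ℂ)
  AlgHom.commutes (FreeAlgebra.lift ℂ (fun x : X ⊕ X => MulOpposite.op
    (Sum.elim genStar gen x : FreeStarAlgebra X)) :
      FreeAlgebra ℂ (X ⊕ X) →ₐ[ℂ] (FreeStarAlgebra X)ᵐᵒᵖ) c

instance : StarRing (FreeStarAlgebra X) where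
  star a := (conjHom X a).unop
  star_involutive a := by
    induction a using induction with
    | algebraMap c => simp [conjHom_algebraMap]
    | gen x => simp [conjHom_gen, conjHom_genStar]
    | genStar x => simp [conjHom_gen, conjHom_genStar]
    | mul a b ha hb => simp only [map_mul, MulOpposite.unop_mul, ha, hb]
    | add a b ha hb => simp only [map_add, MulOpposite.unop_add, ha, hb]
  star_mul a b := by simp
  star_add a b := by simp

theorem star_gen (x : X) : star (gen x) = genStar x := by
  change (conjHom X (gen x)).unop = _
  rw [conjHom_gen]; rfl

theorem star_algebraMap (c : ℂ) :
    star (algebraMap ℂ (FreeStarAlgebra X) c) = algebraMap ℂ _ (conj c) := by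
  change (conjHom X _).unop = _
  rw [conjHom_algebraMap]; rfl

instance : StarModule ℂ (FreeStarAlgebra X) where
  star_smul c a := by
    rw [Algebra.smul_def, star_mul, star_algebraMap, Algebra.smul_def, Algebra.commutes]; rfl

/-- The extension of a map of generators to an algebra homomorphism, sending `x*` to the adjoint
of the image of `x`. -/
def preLift {B : Type*} [Ring B] [StarRing B] [Algebra ℂ B] (g : X → B) :
    FreeStarAlgebra X →ₐ[ℂ] B :=
  (FreeAlgebra.lift ℂ (Sum.elim g fun x => star (g x)) : FreeAlgebra ℂ (X ⊕ X) →ₐ[ℂ] B)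

theorem preLift_gen {B : Type*} [Ring B] [StarRing B] [Algebra ℂ B] (g : X → B) (x : X) :
    preLift g (gen x) = g x :=
  FreeAlgebra.lift_ι_apply (R := ℂ) (Sum.elim g fun x => star (g x)) (Sum.inl x)

theorem preLift_genStar {B : Type*} [Ring B] [StarRing B] [Algebra ℂ B] (g : X → B) (x : X) :
    preLift g (genStar x) = star (g x) :=
  FreeAlgebra.lift_ι_apply (R := ℂ) (Sum.elim g fun x => star (g x)) (Sum.inr x)

/-- The universal property of the free `*`-algebra. -/
def lift {B : Type*} [Ring B] [StarRing B] [Algebra ℂ B] [StarModule ℂ B] (g : X → B) :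
    FreeStarAlgebra X →⋆ₐ[ℂ] B :=
  { preLift g with
    map_star' := by
      intro a
      change preLift g (star a) = star (preLift g a)
      induction a using induction with
      | algebraMap c =>
        rw [star_algebraMap, AlgHom.commutes, AlgHom.commutes, ← algebraMap_star_comm]; rfl
      | gen x => rw [star_gen, preLift_gen, preLift_genStar]
      | genStar x =>
        rw [← star_gen, star_star, star_gen, preLift_gen, preLift_genStar, star_star]
      | mul a b ha hb => rw [star_mul, map_mul, map_mul, ha, hb, star_mul]
      | add a b ha hb => rw [star_add, map_add, map_add, ha, hb, star_add] }

@[simp]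
theorem lift_gen {B : Type*} [Ring B] [StarRing B] [Algebra ℂ B] [StarModule ℂ B] (g : X → B)
    (x : X) : lift g (gen x) = g x :=
  preLift_gen g x

end FreeStarAlgebra

/-- A directed graph with vertices `V` and edges `E`; loops and multiple edges are allowed. -/
structure DirectedGraph (V E : Type*) where
  /-- the source of an edge -/
  src : E → V
  /-- the range of an edge -/
  rng : E → V

namespace DirectedGraph

variable {V E : Type*}

/-- A Cuntz–Krieger family for the row-finite graph `G` in a `*`-algebra `B`. In `ck2` the finite
set `t` is the set of all edges with source `v`, and `v` is not a sink. -/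
structure CKFamily (G : DirectedGraph V E) (B : Type*) [NonUnitalRing B] [StarRing B] where
  /-- the projections -/
  P : V → B
  /-- the partial isometries -/
  S : E → B
  isStarProjection : ∀ v, IsStarProjection (P v)
  orthogonal : ∀ v w, v ≠ w → P v * P w = 0
  partialIsometry : ∀ e, S e * star (S e) * S e = S e
  ck1 : ∀ e, star (S e) * S e = P (G.rng e)
  ck2 : ∀ (v : V) (t : Finset E), (∀ e, e ∈ t ↔ G.src e = v) → t.Nonempty →
    ∑ e ∈ t, S e * star (S e) = P v

variable (G : DirectedGraph V E)

/-- The free `*`-algebra on the vertices and the edges of a graph. -/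
abbrev FreeAlg (_ : DirectedGraph V E) : Type _ := FreeStarAlgebra (V ⊕ E)

/-- The generator of the free `*`-algebra attached to a vertex. -/
def genP (v : V) : G.FreeAlg := FreeStarAlgebra.gen (Sum.inl v)

/-- The generator of the free `*`-algebra attached to an edge. -/
def genS (e : E) : G.FreeAlg := FreeStarAlgebra.gen (Sum.inr e)

/-- The relations of a Cuntz–Krieger family, as pairs of elements of the free `*`-algebra. -/
inductive Rel : G.FreeAlg → G.FreeAlg → Prop
  | idem (v : V) : Rel (G.genP v * G.genP v) (G.genP v)
  | selfAdjoint (v : V) : Rel (star (G.genP v)) (G.genP v)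
  | orthogonal (v w : V) (h : v ≠ w) : Rel (G.genP v * G.genP w) 0
  | partialIsometry (e : E) : Rel (G.genS e * star (G.genS e) * G.genS e) (G.genS e)
  | ck1 (e : E) : Rel (star (G.genS e) * G.genS e) (G.genP (G.rng e))
  | ck2 (v : V) (t : Finset E) (h : ∀ e, e ∈ t ↔ G.src e = v) (hne : t.Nonempty) :
      Rel (∑ e ∈ t, G.genS e * star (G.genS e)) (G.genP v)

/-- The `C*`-seminorms on the free `*`-algebra for which the Cuntz–Krieger relations hold. -/
structure IsCKSeminorm (p : G.FreeAlg → ℝ) : Prop where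
  nonneg : ∀ a, 0 ≤ p a
  add_le : ∀ a b, p (a + b) ≤ p a + p b
  smul : ∀ (c : ℂ) a, p (c • a) = ‖c‖ * p a
  mul_le : ∀ a b, p (a * b) ≤ p a * p b
  star_mul_self : ∀ a, p (star a * a) = p a ^ 2
  rel : ∀ a b, G.Rel a b → p (a - b) = 0

namespace IsCKSeminorm

variable {G} {p : G.FreeAlg → ℝ}

theorem zero (hp : G.IsCKSeminorm p) : p 0 = 0 := by
  simpa using hp.smul 0 0

theorem neg (hp : G.IsCKSeminorm p) (a : G.FreeAlg) : p (-a) = p a := by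
  simpa using hp.smul (-1) a

theorem le_of_sub (hp : G.IsCKSeminorm p) {a b : G.FreeAlg} (h : p (a - b) = 0) : p a ≤ p b := by
  have := hp.add_le (a - b) b
  rwa [sub_add_cancel, h, zero_add] at this

theorem le_star (hp : G.IsCKSeminorm p) (a : G.FreeAlg) : p a ≤ p (star a) := by
  have h1 := hp.star_mul_self a
  have h2 := hp.mul_le (star a) a
  by_contra h
  have h3 := hp.nonneg a
  have h4 := hp.nonneg (star a)
  nlinarith

theorem star_eq (hp : G.IsCKSeminorm p) (a : G.FreeAlg) : p (star a) = p a :=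
  le_antisymm (by simpa using hp.le_star (star a)) (hp.le_star a)

theorem one_le (hp : G.IsCKSeminorm p) : p 1 ≤ 1 := by
  have := hp.star_mul_self 1
  rw [star_one, one_mul] at this
  nlinarith

theorem genP_le (hp : G.IsCKSeminorm p) (v : V) : p (G.genP v) ≤ 1 := by
  have h1 : p (star (G.genP v) * G.genP v - G.genP v * G.genP v) = 0 := by
    rw [← sub_mul]
    refine le_antisymm ((hp.mul_le _ _).trans ?_) (hp.nonneg _)
    rw [hp.rel _ _ (.selfAdjoint v), zero_mul]
  have h2 := (hp.le_of_sub h1).trans (hp.le_of_sub (hp.rel _ _ (.idem v)))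
  rw [hp.star_mul_self] at h2
  nlinarith

theorem genS_le (hp : G.IsCKSeminorm p) (e : E) : p (G.genS e) ≤ 1 := by
  have h := (hp.le_of_sub (hp.rel _ _ (.ck1 e))).trans (hp.genP_le _)
  rw [hp.star_mul_self] at h
  nlinarith

end IsCKSeminorm

theorem exists_bound (a : G.FreeAlg) : ∃ C : ℝ, ∀ p, G.IsCKSeminorm p → p a ≤ C := by
  induction a using FreeStarAlgebra.induction with
  | algebraMap c =>
    refine ⟨‖c‖, fun p hp => ?_⟩
    rw [Algebra.algebraMap_eq_smul_one, hp.smul]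
    exact mul_le_of_le_one_right (norm_nonneg _) hp.one_le
  | gen x =>
    refine ⟨1, fun p hp => ?_⟩
    rcases x with v | e
    · exact hp.genP_le v
    · exact hp.genS_le e
  | genStar x =>
    refine ⟨1, fun p hp => ?_⟩
    rw [← FreeStarAlgebra.star_gen, hp.star_eq]
    rcases x with v | e
    · exact hp.genP_le v
    · exact hp.genS_le e
  | mul a b ha hb =>
    obtain ⟨C, hC⟩ := ha
    obtain ⟨D, hD⟩ := hb
    exact ⟨C * D, fun p hp => (hp.mul_le a b).trans (mul_le_mul (hC p hp) (hD p hp) (hp.nonneg b)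
      ((hp.nonneg a).trans (hC p hp)))⟩
  | add a b ha hb =>
    obtain ⟨C, hC⟩ := ha
    obtain ⟨D, hD⟩ := hb
    exact ⟨C + D, fun p hp => (hp.add_le a b).trans (add_le_add (hC p hp) (hD p hp))⟩

/-- The universal `C*`-seminorm: the supremum of all `C*`-seminorms for which the Cuntz–Krieger
relations hold. -/
def univNorm (a : G.FreeAlg) : ℝ := ⨆ p : {p : G.FreeAlg → ℝ // G.IsCKSeminorm p}, p.1 a

theorem le_univNorm {p : G.FreeAlg → ℝ} (hp : G.IsCKSeminorm p) (a : G.FreeAlg) :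
    p a ≤ G.univNorm a := by
  obtain ⟨C, hC⟩ := G.exists_bound a
  exact le_ciSup (f := fun p : {p : G.FreeAlg → ℝ // G.IsCKSeminorm p} => p.1 a)
    ⟨C, by rintro _ ⟨q, rfl⟩; exact hC _ q.2⟩ ⟨p, hp⟩

theorem univNorm_nonneg (a : G.FreeAlg) : 0 ≤ G.univNorm a :=
  Real.iSup_nonneg fun p => p.2.nonneg a

theorem univNorm_le {a : G.FreeAlg} {C : ℝ} (hC : 0 ≤ C)
    (h : ∀ p, G.IsCKSeminorm p → p a ≤ C) : G.univNorm a ≤ C :=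
  Real.iSup_le (fun p => h _ p.2) hC

theorem isCKSeminorm_univNorm : G.IsCKSeminorm G.univNorm where
  nonneg := G.univNorm_nonneg
  add_le a b := G.univNorm_le (add_nonneg (G.univNorm_nonneg a) (G.univNorm_nonneg b))
    fun _ hp => (hp.add_le a b).trans (add_le_add (G.le_univNorm hp a) (G.le_univNorm hp b))
  smul c a := by
    rw [univNorm, univNorm, Real.mul_iSup_of_nonneg (norm_nonneg c)]
    exact iSup_congr fun p => p.2.smul c a
  mul_le a b := G.univNorm_le (mul_nonneg (G.univNorm_nonneg a) (G.univNorm_nonneg b))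
    fun _ hp => (hp.mul_le a b).trans (mul_le_mul (G.le_univNorm hp a) (G.le_univNorm hp b)
      (hp.nonneg b) (G.univNorm_nonneg a))
  star_mul_self a := by
    apply le_antisymm
    · refine G.univNorm_le (sq_nonneg _) fun p hp => ?_
      rw [hp.star_mul_self]
      exact pow_le_pow_left₀ (hp.nonneg a) (G.le_univNorm hp a) 2
    · rw [← Real.le_sqrt (G.univNorm_nonneg _) (G.univNorm_nonneg _)]
      refine G.univNorm_le (Real.sqrt_nonneg _) fun p hp => ?_
      apply Real.le_sqrt_of_sq_le
      rw [← hp.star_mul_self]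
      exact G.le_univNorm hp _
  rel a b h := le_antisymm (G.univNorm_le le_rfl fun p hp => (hp.rel a b h).le)
    (G.univNorm_nonneg _)

/-- The free `*`-algebra on the vertices and the edges, carrying the universal `C*`-seminorm. -/
def PreAlg (G : DirectedGraph V E) : Type _ := G.FreeAlg

instance : Ring G.PreAlg := inferInstanceAs (Ring G.FreeAlg)
instance : Algebra ℂ G.PreAlg := inferInstanceAs (Algebra ℂ G.FreeAlg)
instance : StarRing G.PreAlg := inferInstanceAs (StarRing G.FreeAlg)
instance : StarModule ℂ G.PreAlg := inferInstanceAs (StarModule ℂ G.FreeAlg)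

/-- The universal `C*`-seminorm as a ring seminorm. -/
def univRingSeminorm : RingSeminorm G.PreAlg where
  toFun := G.univNorm
  map_zero' := G.isCKSeminorm_univNorm.zero
  add_le' := G.isCKSeminorm_univNorm.add_le
  neg' := G.isCKSeminorm_univNorm.neg
  mul_le' := G.isCKSeminorm_univNorm.mul_le

instance : SeminormedRing G.PreAlg := G.univRingSeminorm.toSeminormedRing

theorem PreAlg.norm_def (a : G.PreAlg) : ‖a‖ = G.univNorm a := rfl

instance : NormedAlgebra ℂ G.PreAlg where
  norm_smul_le c a := (G.isCKSeminorm_univNorm.smul c a).le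

instance : NormedStarGroup G.PreAlg where
  norm_star_le a := (G.isCKSeminorm_univNorm.star_eq a).le

/-- The Hausdorff completion of the free `*`-algebra in the universal `C*`-seminorm: the universal
unital `C*`-algebra generated by a Cuntz–Krieger family. -/
def UnitalAlg (G : DirectedGraph V E) : Type _ := UniformSpace.Completion G.PreAlg

namespace UnitalAlg

open UniformSpace

instance : NormedRing G.UnitalAlg := inferInstanceAs (NormedRing (Completion G.PreAlg))
instance : CompleteSpace G.UnitalAlg := inferInstanceAs (CompleteSpace (Completion G.PreAlg))

instance : NormedAlgebra ℂ G.UnitalAlg :=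
  { (inferInstanceAs (Algebra ℂ (Completion G.PreAlg)) : Algebra ℂ G.UnitalAlg) with
    norm_smul_le := fun c (a : Completion G.PreAlg) =>
      (norm_smul_le c a : ‖c • a‖ ≤ ‖c‖ * ‖a‖) }


instance : Star G.UnitalAlg := ⟨Completion.map (star : G.PreAlg → G.PreAlg)⟩

/-- The canonical map from the free `*`-algebra to its completion. -/
def of (a : G.FreeAlg) : G.UnitalAlg := Completion.coe' (α := G.PreAlg) a

theorem norm_of (a : G.FreeAlg) : ‖of G a‖ = G.univNorm a :=
  Completion.norm_coe (E := G.PreAlg) a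

theorem of_add (a b : G.FreeAlg) : of G (a + b) = of G a + of G b :=
  Completion.coe_add (α := G.PreAlg) a b

theorem of_sub (a b : G.FreeAlg) : of G (a - b) = of G a - of G b :=
  Completion.coe_sub (α := G.PreAlg) a b

theorem of_mul (a b : G.FreeAlg) : of G (a * b) = of G a * of G b :=
  Completion.coe_mul (α := G.PreAlg) a b

theorem of_zero : of G 0 = 0 := Completion.coe_zero (α := G.PreAlg)

theorem of_one : of G 1 = 1 := Completion.coe_one (α := G.PreAlg)

theorem of_smul (c : ℂ) (a : G.FreeAlg) : of G (c • a) = c • of G a :=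
  Completion.coe_smul (X := G.PreAlg) c a

theorem of_sum {ι : Type*} (t : Finset ι) (a : ι → G.FreeAlg) :
    of G (∑ i ∈ t, a i) = ∑ i ∈ t, of G (a i) := by
  classical
  induction t using Finset.induction_on with
  | empty => exact of_zero G
  | insert i t hi ih => rw [Finset.sum_insert hi, Finset.sum_insert hi, of_add, ih]

theorem of_star (a : G.FreeAlg) : of G (star a) = star (of G a) :=
  (Completion.map_coe (α := G.PreAlg) (β := G.PreAlg)
    (star_isometry (E := G.PreAlg)).uniformContinuous a).symm

theorem continuous_star' : Continuous (star : G.UnitalAlg → G.UnitalAlg) :=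
  Completion.continuous_map (α := G.PreAlg) (β := G.PreAlg)

theorem denseRange_of : DenseRange (of G) := Completion.denseRange_coe (α := G.PreAlg)

theorem induction {p : G.UnitalAlg → Prop} (x : G.UnitalAlg) (hp : IsClosed {x | p x})
    (h : ∀ a, p (of G a)) : p x :=
  Completion.induction_on (α := G.PreAlg) x hp h

theorem induction₂ {p : G.UnitalAlg → G.UnitalAlg → Prop} (x y : G.UnitalAlg)
    (hp : IsClosed {x : G.UnitalAlg × G.UnitalAlg | p x.1 x.2})
    (h : ∀ a b, p (of G a) (of G b)) : p x y :=
  Completion.induction_on₂ (α := G.PreAlg) (β := G.PreAlg) x y hp h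

instance : StarRing G.UnitalAlg where
  star_involutive x := by
    refine induction G (p := fun x => star (star x) = x) x (isClosed_eq ?_ continuous_id) fun a => ?_
    · exact (continuous_star' G).comp (continuous_star' G)
    · rw [← of_star, ← of_star, star_star]
  star_mul x y := by
    have := continuous_star' G
    refine induction₂ G (p := fun x y => star (x * y) = star y * star x) x y
      (isClosed_eq (by fun_prop) (by fun_prop)) fun a b => ?_
    rw [← of_mul, ← of_star, ← of_star, ← of_star, ← of_mul, star_mul]
  star_add x y := by
    have := continuous_star' G
    refine induction₂ G (p := fun x y => star (x + y) = star x + star y) x y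
      (isClosed_eq (by fun_prop) (by fun_prop)) fun a b => ?_
    rw [← of_add, ← of_star, ← of_star, ← of_star, ← of_add, star_add]

instance : StarModule ℂ G.UnitalAlg where
  star_smul c x := by
    have h1 : Continuous fun x : G.UnitalAlg => star (c • x) :=
      (continuous_star' G).comp (continuous_const_smul c)
    have h2 : Continuous fun x : G.UnitalAlg => star c • star x :=
      (continuous_const_smul (star c)).comp (continuous_star' G)
    refine induction G (p := fun x => star (c • x) = star c • star x) x
      (isClosed_eq h1 h2) fun a => ?_
    rw [← of_smul, ← of_star, ← of_star, ← of_smul, star_smul]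

instance : CStarRing G.UnitalAlg where
  norm_mul_self_le x := by
    have := continuous_star' G
    refine induction G (p := fun x => ‖x‖ * ‖x‖ ≤ ‖star x * x‖) x
      (isClosed_le (by fun_prop) (by fun_prop)) fun a => ?_
    rw [← of_star, ← of_mul, norm_of, norm_of, G.isCKSeminorm_univNorm.star_mul_self, sq]

instance : CStarAlgebra G.UnitalAlg where

theorem of_rel {a b : G.FreeAlg} (h : G.Rel a b) : of G a = of G b := by
  rw [← sub_eq_zero, ← of_sub, ← norm_eq_zero, norm_of]
  exact G.isCKSeminorm_univNorm.rel a b h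

end UnitalAlg

/-- The closed `*`-subalgebra of the universal unital algebra generated by the Cuntz–Krieger
family. -/
def generated (G : DirectedGraph V E) : NonUnitalStarSubalgebra ℂ G.UnitalAlg :=
  (NonUnitalStarAlgebra.adjoin ℂ
    (Set.range (fun v => UnitalAlg.of G (G.genP v)) ∪
      Set.range (fun e => UnitalAlg.of G (G.genS e)))).topologicalClosure

/-- The graph `C*`-algebra `C*(G)` of a row-finite graph `G`. It is generated as a `C*`-algebra by
the Cuntz–Krieger family `CStar.family G`, and it is universal for this property, see
`CStar.lift` and `CStar.hom_ext`. -/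
def CStar (G : DirectedGraph V E) : Type _ := G.generated

namespace CStar

instance : IsClosed (G.generated : Set G.UnitalAlg) :=
  NonUnitalStarSubalgebra.isClosed_topologicalClosure _

instance : NonUnitalCStarAlgebra G.CStar :=
  inferInstanceAs (NonUnitalCStarAlgebra G.generated)

/-- The inclusion of `C*(G)` in its unital envelope. -/
def incl : G.CStar →⋆ₙₐ[ℂ] G.UnitalAlg := NonUnitalStarSubalgebraClass.subtype G.generated

theorem incl_injective : Function.Injective (incl G) := Subtype.val_injective

/-- The projections generating `C*(G)`. -/
def proj (v : V) : G.CStar :=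
  ⟨UnitalAlg.of G (G.genP v), NonUnitalStarSubalgebra.le_topologicalClosure _
    (NonUnitalStarAlgebra.subset_adjoin ℂ _ (Or.inl ⟨v, rfl⟩))⟩

/-- The partial isometries generating `C*(G)`. -/
def isom (e : E) : G.CStar :=
  ⟨UnitalAlg.of G (G.genS e), NonUnitalStarSubalgebra.le_topologicalClosure _
    (NonUnitalStarAlgebra.subset_adjoin ℂ _ (Or.inr ⟨e, rfl⟩))⟩

theorem incl_proj (v : V) : incl G (proj G v) = UnitalAlg.of G (G.genP v) := rfl

theorem incl_isom (e : E) : incl G (isom G e) = UnitalAlg.of G (G.genS e) := rfl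

/-- The universal Cuntz–Krieger family, which generates `C*(G)`. -/
def family : CKFamily G G.CStar where
  P := proj G
  S := isom G
  isStarProjection v := by
    refine ⟨incl_injective G ?_, incl_injective G ?_⟩
    · rw [map_mul, incl_proj, ← UnitalAlg.of_mul, UnitalAlg.of_rel G (.idem v)]
    · rw [map_star, incl_proj, ← UnitalAlg.of_star, UnitalAlg.of_rel G (.selfAdjoint v)]
  orthogonal v w h := incl_injective G <| by
    rw [map_mul, map_zero, incl_proj, incl_proj, ← UnitalAlg.of_mul,
      UnitalAlg.of_rel G (.orthogonal v w h), UnitalAlg.of_zero]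
  partialIsometry e := incl_injective G <| by
    rw [map_mul, map_mul, map_star, incl_isom, ← UnitalAlg.of_star, ← UnitalAlg.of_mul,
      ← UnitalAlg.of_mul, UnitalAlg.of_rel G (.partialIsometry e)]
  ck1 e := incl_injective G <| by
    rw [map_mul, map_star, incl_isom, incl_proj, ← UnitalAlg.of_star, ← UnitalAlg.of_mul,
      UnitalAlg.of_rel G (.ck1 e)]
  ck2 v t h hne := incl_injective G <| by
    simp only [map_sum, map_mul, map_star, incl_isom, incl_proj, ← UnitalAlg.of_star,
      ← UnitalAlg.of_mul]
    rw [← UnitalAlg.of_rel G (.ck2 v t h hne), UnitalAlg.of_sum]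

/-- `C*(G)` is generated by its Cuntz–Krieger family: a closed `*`-subalgebra that contains the
family is everything. -/
theorem eq_top_of_isClosed (T : NonUnitalStarSubalgebra ℂ G.CStar)
    (hT : IsClosed (T : Set G.CStar)) (hP : ∀ v, (family G).P v ∈ T)
    (hS : ∀ e, (family G).S e ∈ T) (x : G.CStar) : x ∈ T := by
  have hcl : IsClosed ((T.map (incl G) : NonUnitalStarSubalgebra ℂ G.UnitalAlg) :
      Set G.UnitalAlg) := by
    rw [NonUnitalStarSubalgebra.coe_map]
    have : Topology.IsClosedEmbedding (Subtype.val : G.generated → G.UnitalAlg) :=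
      (NonUnitalStarSubalgebra.isClosed_topologicalClosure _).isClosedEmbedding_subtypeVal
    exact this.isClosedMap _ hT
  have hle : G.generated ≤ T.map (incl G) := by
    refine NonUnitalStarSubalgebra.topologicalClosure_minimal _ ?_ hcl
    refine NonUnitalStarAlgebra.adjoin_le ?_
    rintro _ (⟨v, rfl⟩ | ⟨e, rfl⟩)
    · exact ⟨_, hP v, rfl⟩
    · exact ⟨_, hS e, rfl⟩
  obtain ⟨y, hy, hyx⟩ := hle x.2
  have : y = x := incl_injective G hyx
  exact this ▸ hy

variable {G} {B : Type*} [NonUnitalCStarAlgebra B]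

theorem continuous_hom {A B : Type*} [NonUnitalCStarAlgebra A] [NonUnitalCStarAlgebra B]
    (φ : A →⋆ₙₐ[ℂ] B) : Continuous φ :=
  AddMonoidHomClass.continuous_of_bound φ 1 fun a => by
    simpa using NonUnitalStarAlgHom.norm_apply_le φ a

/-- Two `*`-homomorphisms on `C*(G)` that agree on the Cuntz–Krieger family are equal. -/
theorem hom_ext {φ ψ : G.CStar →⋆ₙₐ[ℂ] B}
    (hP : ∀ v, φ ((family G).P v) = ψ ((family G).P v))
    (hS : ∀ e, φ ((family G).S e) = ψ ((family G).S e)) : φ = ψ := by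
  ext x
  exact eq_top_of_isClosed G (NonUnitalStarAlgHom.equalizer φ ψ)
    (isClosed_eq (continuous_hom φ) (continuous_hom ψ)) hP hS x

variable (F : CKFamily G B)

/-- The `*`-homomorphism on the free `*`-algebra given by a Cuntz–Krieger family. -/
def freeLift : G.FreeAlg →⋆ₐ[ℂ] Unitization ℂ B :=
  FreeStarAlgebra.lift
    (Sum.elim (fun v => (F.P v : Unitization ℂ B)) fun e => (F.S e : Unitization ℂ B))

theorem freeLift_genP (v : V) : freeLift F (G.genP v) = (F.P v : Unitization ℂ B) :=
  FreeStarAlgebra.lift_gen _ _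

theorem freeLift_genS (e : E) : freeLift F (G.genS e) = (F.S e : Unitization ℂ B) :=
  FreeStarAlgebra.lift_gen _ _

theorem freeLift_rel {a b : G.FreeAlg} (h : G.Rel a b) : freeLift F a = freeLift F b := by
  induction h with
  | idem v =>
    rw [map_mul, freeLift_genP, ← Unitization.inr_mul, (F.isStarProjection v).isIdempotentElem.eq]
  | selfAdjoint v =>
    rw [map_star, freeLift_genP, ← Unitization.inr_star,
      (F.isStarProjection v).isSelfAdjoint.star_eq]
  | orthogonal v w h =>
    rw [map_mul, freeLift_genP, freeLift_genP, ← Unitization.inr_mul, F.orthogonal v w h,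
      Unitization.inr_zero, map_zero]
  | partialIsometry e =>
    rw [map_mul, map_mul, map_star, freeLift_genS, ← Unitization.inr_star, ← Unitization.inr_mul,
      ← Unitization.inr_mul, F.partialIsometry]
  | ck1 e =>
    rw [map_mul, map_star, freeLift_genS, freeLift_genP, ← Unitization.inr_star,
      ← Unitization.inr_mul, F.ck1]
  | ck2 v t h hne =>
    simp only [map_sum, map_mul, map_star, freeLift_genS, freeLift_genP, ← Unitization.inr_star,
      ← Unitization.inr_mul]
    rw [← F.ck2 v t h hne]
    exact (map_sum (Unitization.inrNonUnitalAlgHom ℂ B) _ _).symm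

theorem isCKSeminorm_freeLift : G.IsCKSeminorm fun a => ‖freeLift F a‖ where
  nonneg a := norm_nonneg _
  add_le a b := by rw [map_add]; exact norm_add_le _ _
  smul c a := by rw [map_smul, norm_smul]
  mul_le a b := by rw [map_mul]; exact norm_mul_le _ _
  star_mul_self a := by rw [map_mul, map_star, CStarRing.norm_star_mul_self, sq]
  rel a b h := by rw [map_sub, freeLift_rel F h, sub_self, norm_zero]

/-- `freeLift` as a ring homomorphism on the seminormed algebra. -/
def preLift : G.PreAlg →+* Unitization ℂ B := (freeLift F : G.FreeAlg →+* Unitization ℂ B)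

theorem continuous_preLift : Continuous (preLift F) :=
  AddMonoidHomClass.continuous_of_bound (preLift F) 1 fun a => by
    rw [one_mul]; exact G.le_univNorm (isCKSeminorm_freeLift F) a

/-- The extension of `freeLift` to the universal unital algebra. -/
def unitalLift : G.UnitalAlg →+* Unitization ℂ B :=
  UniformSpace.Completion.extensionHom (preLift F) (continuous_preLift F)

theorem continuous_unitalLift : Continuous (unitalLift F) :=
  UniformSpace.Completion.continuous_extension (α := G.PreAlg)

theorem unitalLift_of (a : G.FreeAlg) : unitalLift F (UnitalAlg.of G a) = freeLift F a :=
  UniformSpace.Completion.extensionHom_coe (preLift F) (continuous_preLift F) a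

theorem unitalLift_star (x : G.UnitalAlg) : unitalLift F (star x) = star (unitalLift F x) := by
  have := continuous_unitalLift F
  refine UnitalAlg.induction G (p := fun x => unitalLift F (star x) = star (unitalLift F x)) x
    (isClosed_eq (by fun_prop) (by fun_prop)) fun a => ?_
  rw [← UnitalAlg.of_star, unitalLift_of, unitalLift_of, map_star]

theorem unitalLift_smul (c : ℂ) (x : G.UnitalAlg) :
    unitalLift F (c • x) = c • unitalLift F x := by
  have h1 : Continuous fun x : G.UnitalAlg => unitalLift F (c • x) :=
    (continuous_unitalLift F).comp (continuous_const_smul c)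
  have h2 : Continuous fun x : G.UnitalAlg => c • unitalLift F x :=
    (continuous_unitalLift F).const_smul c
  refine UnitalAlg.induction G (p := fun x => unitalLift F (c • x) = c • unitalLift F x) x
    (isClosed_eq h1 h2) fun a => ?_
  rw [← UnitalAlg.of_smul, unitalLift_of, unitalLift_of, map_smul]

/-- `unitalLift` as a `*`-homomorphism on `C*(G)`. -/
def liftAux : G.CStar →⋆ₙₐ[ℂ] Unitization ℂ B :=
  { toFun := fun x => unitalLift F (incl G x)
    map_smul' := fun c x => by rw [map_smul, unitalLift_smul]; rfl
    map_zero' := by rw [map_zero, map_zero]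
    map_add' := fun x y => by rw [map_add, map_add]
    map_mul' := fun x y => by rw [map_mul, map_mul]
    map_star' := fun x => by rw [map_star, unitalLift_star] }

theorem liftAux_P (v : V) : liftAux F ((family G).P v) = (F.P v : Unitization ℂ B) :=
  (unitalLift_of F _).trans (freeLift_genP F v)

theorem liftAux_S (e : E) : liftAux F ((family G).S e) = (F.S e : Unitization ℂ B) :=
  (unitalLift_of F _).trans (freeLift_genS F e)

theorem exists_liftAux_eq (x : G.CStar) : ∃ b : B, (b : Unitization ℂ B) = liftAux F x := by
  have hcl : IsClosed (Set.range (Unitization.inr : B → Unitization ℂ B)) :=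
    (Unitization.isometry_inr (𝕜 := ℂ) (A := B)).isClosedEmbedding.isClosed_range
  refine eq_top_of_isClosed G
    ((NonUnitalStarAlgHom.range (Unitization.inrNonUnitalStarAlgHom ℂ B)).comap (liftAux F))
    ?_ (fun v => ⟨F.P v, (liftAux_P F v).symm⟩) (fun e => ⟨F.S e, (liftAux_S F e).symm⟩) x
  exact hcl.preimage (continuous_hom (liftAux F))

theorem inr_snd_liftAux (x : G.CStar) :
    ((liftAux F x).snd : Unitization ℂ B) = liftAux F x := by
  obtain ⟨b, hb⟩ := exists_liftAux_eq F x
  rw [← hb, Unitization.snd_inr]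

/-- The universal property of `C*(G)`: a Cuntz–Krieger family in a `C*`-algebra `B` gives a
`*`-homomorphism from `C*(G)` to `B`. -/
def lift : G.CStar →⋆ₙₐ[ℂ] B :=
  { toFun := fun x => (liftAux F x).snd
    map_smul' := fun c x => by rw [map_smul, Unitization.snd_smul]; rfl
    map_zero' := by rw [map_zero, Unitization.snd_zero]
    map_add' := fun x y => by rw [map_add, Unitization.snd_add]
    map_mul' := fun x y => Unitization.inr_injective (R := ℂ) <| by
      rw [Unitization.inr_mul, inr_snd_liftAux, inr_snd_liftAux, inr_snd_liftAux, map_mul]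
    map_star' := fun x => by rw [map_star, Unitization.snd_star] }

@[simp]
theorem lift_P (v : V) : lift F ((family G).P v) = F.P v := by
  change (liftAux F ((family G).P v)).snd = F.P v
  rw [liftAux_P, Unitization.snd_inr]

@[simp]
theorem lift_S (e : E) : lift F ((family G).S e) = F.S e := by
  change (liftAux F ((family G).S e)).snd = F.S e
  rw [liftAux_S, Unitization.snd_inr]

end CStar
end DirectedGraph

section CircleTensor

variable {A B : Type*} [NonUnitalCStarAlgebra A] [NonUnitalCStarAlgebra B]

/-- The `C*`-tensor product `A ⊗ C(S¹)`, realised as the `C*`-algebra of continuous functions from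
the circle to `A`, the elementary tensor `a ⊗ g` being the function `z ↦ g z • a`. The algebraic
tensor product is a dense `*`-subalgebra, see `CircleTensor.ofAlgebraic_injective` and
`CircleTensor.denseRange_ofAlgebraic`; its `C*`-norm is unique because `C(S¹)` is nuclear. -/
abbrev CircleTensor (A : Type*) [NonUnitalCStarAlgebra A] : Type _ := C(Circle, A)

/-- The elementary tensor `a ⊗ g`. -/
def elemTensor (a : A) (g : C(Circle, ℂ)) : CircleTensor A :=
  ⟨fun z => g z • a, by fun_prop⟩

/-- The standard unitary generator `u` of `C(S¹)`. -/
def circleU : C(Circle, ℂ) := ⟨fun z => (z : ℂ), by fun_prop⟩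

/-- The homomorphism `φ ⊗ id`. -/
def tensorId (φ : A →⋆ₙₐ[ℂ] B) : CircleTensor A →⋆ₙₐ[ℂ] CircleTensor B :=
  { toFun := fun g => ⟨fun z => φ (g z),
      (DirectedGraph.CStar.continuous_hom φ).comp g.continuous⟩
    map_smul' := fun c g => by ext z; simp
    map_zero' := by ext z; simp
    map_add' := fun g h => by ext z; simp
    map_mul' := fun g h => by ext z; simp
    map_star' := fun g => by ext z; simp [map_star] }

namespace CircleTensor

@[simp]
theorem elemTensor_apply (a : A) (g : C(Circle, ℂ)) (z : Circle) : elemTensor a g z = g z • a :=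
  rfl

theorem elemTensor_mul (a b : A) (g h : C(Circle, ℂ)) :
    elemTensor a g * elemTensor b h = elemTensor (a * b) (g * h) := by
  ext z
  simp [smul_mul_smul_comm]

theorem star_elemTensor (a : A) (g : C(Circle, ℂ)) :
    star (elemTensor a g) = elemTensor (star a) (star g) := by
  ext z
  simp

theorem zero_elemTensor (g : C(Circle, ℂ)) : elemTensor (0 : A) g = 0 := by
  ext z
  simp

theorem sum_elemTensor {ι : Type*} (t : Finset ι) (a : ι → A) (g : C(Circle, ℂ)) :
    elemTensor (∑ i ∈ t, a i) g = ∑ i ∈ t, elemTensor (a i) g := by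
  ext z
  simp [Finset.smul_sum]

theorem star_circleU_mul : star circleU * circleU = 1 := by
  ext z
  change star (z : ℂ) * (z : ℂ) = 1
  rw [Complex.star_def, ← Complex.normSq_eq_conj_mul_self, Circle.normSq_coe, Complex.ofReal_one]

theorem circleU_mul_star : circleU * star circleU = 1 := by
  rw [mul_comm, star_circleU_mul]

theorem tensorId_elemTensor (φ : A →⋆ₙₐ[ℂ] B) (a : A) (g : C(Circle, ℂ)) :
    tensorId φ (elemTensor a g) = elemTensor (φ a) g := by
  ext z
  exact map_smul φ (g z) a

open scoped TensorProduct in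
/-- The canonical map from the algebraic tensor product. -/
def ofAlgebraic (A : Type*) [NonUnitalCStarAlgebra A] :
    A ⊗[ℂ] C(Circle, ℂ) →ₗ[ℂ] CircleTensor A :=
  TensorProduct.lift (LinearMap.mk₂ ℂ elemTensor
    (fun a b g => by ext z; simp) (fun c a g => by ext z; simp [smul_comm c])
    (fun a g h => by ext z; simp [add_smul]) (fun c a g => by ext z; simp [mul_smul]))

open scoped TensorProduct in
theorem ofAlgebraic_tmul (a : A) (g : C(Circle, ℂ)) :
    ofAlgebraic A (a ⊗ₜ[ℂ] g) = elemTensor a g := rfl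

theorem ofAlgebraic_injective : Function.Injective (ofAlgebraic A) := by
  rw [injective_iff_map_eq_zero]
  intro x hx
  let b := Module.Basis.ofVectorSpace ℂ A
  obtain ⟨c, rfl⟩ := TensorProduct.eq_repr_basis_left b x
  suffices c = 0 by simp [this]
  ext i z
  have h := congrArg (fun g : CircleTensor A => g z) hx
  have h2 : ∑ j ∈ c.support, c j z • b j = 0 := by
    simpa [Finsupp.sum, map_sum, ofAlgebraic_tmul, ContinuousMap.sum_apply] using h
  by_cases hi : i ∈ c.support
  · exact linearIndependent_iff'.mp b.linearIndependent c.support (fun j => c j z) h2 i hi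
  · simp [Finsupp.notMem_support_iff.mp hi]

theorem denseRange_ofAlgebraic : DenseRange (ofAlgebraic A) := by
  intro h
  rw [Metric.mem_closure_range_iff]
  intro ε hε
  have hε2 : 0 < ε / 2 := half_pos hε
  obtain ⟨t, ht⟩ := isCompact_univ.elim_finite_subcover
    (fun a : A => h ⁻¹' Metric.ball a (ε / 2)) (fun a => Metric.isOpen_ball.preimage h.continuous)
    (fun z _ => Set.mem_iUnion.mpr ⟨h z, by simpa using hε2⟩)
  obtain ⟨ρ, hρ⟩ := PartitionOfUnity.exists_isSubordinate (s := (Set.univ : Set Circle))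
    isClosed_univ (fun a : t => h ⁻¹' Metric.ball (a : A) (ε / 2))
    (fun a => Metric.isOpen_ball.preimage h.continuous)
    (fun z hz => by simpa using ht hz)
  let g : t → C(Circle, ℂ) := fun a => ⟨fun z => ((ρ a z : ℝ) : ℂ), by fun_prop⟩
  refine ⟨∑ a : t, (a : A) ⊗ₜ[ℂ] g a, ?_⟩
  rw [ContinuousMap.dist_lt_iff hε]
  intro z
  refine lt_of_le_of_lt ?_ (half_lt_self hε)
  have h1 : ∑ a : t, ρ a z = 1 := by
    rw [← ρ.sum_eq_one (Set.mem_univ z), finsum_eq_sum_of_fintype]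
  have h2 : h z = ∑ a : t, ((ρ a z : ℝ) : ℂ) • h z := by
    rw [← Finset.sum_smul, ← Complex.ofReal_sum, h1, Complex.ofReal_one, one_smul]
  have h3 : ofAlgebraic A (∑ a : t, (a : A) ⊗ₜ[ℂ] g a) z = ∑ a : t, ((ρ a z : ℝ) : ℂ) • (a : A) := by
    rw [map_sum, ContinuousMap.sum_apply]
    rfl
  rw [h3, h2, dist_eq_norm, ← Finset.sum_sub_distrib]
  refine (norm_sum_le _ _).trans ?_
  calc ∑ a : t, ‖((ρ a z : ℝ) : ℂ) • h z - ((ρ a z : ℝ) : ℂ) • (a : A)‖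
      ≤ ∑ a : t, ρ a z * (ε / 2) := by
        refine Finset.sum_le_sum fun a _ => ?_
        rw [← smul_sub, norm_smul, Complex.norm_real, Real.norm_of_nonneg (ρ.nonneg a z)]
        by_cases hz : ρ a z = 0
        · simp [hz]
        · refine mul_le_mul_of_nonneg_left ?_ (ρ.nonneg a z)
          have := hρ a (subset_tsupport _ (Function.mem_support.mpr hz))
          rw [Set.mem_preimage, Metric.mem_ball, dist_eq_norm] at this
          exact this.le
    _ = ε / 2 := by rw [← Finset.sum_mul, h1, one_mul]

end CircleTensor

end CircleTensor

/-- A `U(1)`-`C*`-algebra structure on `A`: a strongly continuous action of the circle group by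
`*`-automorphisms. -/
structure CircleAction (A : Type*) [NonUnitalCStarAlgebra A] where
  /-- the action of an element of the circle group -/
  act : Circle → A →⋆ₙₐ[ℂ] A
  act_one : ∀ a, act 1 a = a
  act_mul : ∀ z w a, act (z * w) a = act z (act w a)
  continuous : ∀ a, Continuous fun z => act z a

/-- The standard action of `U(1)` on the factor `C(S¹)` of `A ⊗ C(S¹)`: it sends `a ⊗ u` to
`a ⊗ z u`. -/
def rotationAction (A : Type*) [NonUnitalCStarAlgebra A] : CircleAction (CircleTensor A) where
  act z :=
    { toFun := fun g => ⟨fun w => g (z * w), by fun_prop⟩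
      map_smul' := fun _ _ => rfl
      map_zero' := rfl
      map_add' := fun _ _ => rfl
      map_mul' := fun _ _ => rfl
      map_star' := fun _ => rfl }
  act_one g := by ext w; exact congrArg g (one_mul w)
  act_mul z w g := by
    ext x
    change g (z * w * x) = g (w * (z * x))
    rw [mul_left_comm, mul_assoc]
  continuous g :=
    (ContinuousMap.curry (⟨fun p : Circle × Circle => g (p.1 * p.2), by fun_prop⟩ :
      C(Circle × Circle, A))).continuous

/-- Equivariance of a `*`-homomorphism of `U(1)`-`C*`-algebras. -/
def IsEquivariant {A B : Type*} [NonUnitalCStarAlgebra A] [NonUnitalCStarAlgebra B]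
    (α : CircleAction A) (β : CircleAction B) (φ : A →⋆ₙₐ[ℂ] B) : Prop :=
  ∀ z a, φ (α.act z a) = β.act z (φ a)

/-- The square with corners `A`, `B`, `C`, `D` and sides `p₁ : A → B`, `p₂ : A → C`, `q₁ : B → D`,
`q₂ : C → D` is a pullback diagram of `U(1)`-`C*`-algebras: all maps are equivariant, the square
commutes, and `a ↦ (p₁ a, p₂ a)` is a bijection from `A` to the pullback `C*`-algebra
`{(b, c) | q₁ b = q₂ c}` with its diagonal action. -/
structure IsEquivariantPullback {A B C D : Type*} [NonUnitalCStarAlgebra A]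
    [NonUnitalCStarAlgebra B] [NonUnitalCStarAlgebra C] [NonUnitalCStarAlgebra D]
    (α : CircleAction A) (β : CircleAction B) (γ : CircleAction C) (ε : CircleAction D)
    (p₁ : A →⋆ₙₐ[ℂ] B) (p₂ : A →⋆ₙₐ[ℂ] C) (q₁ : B →⋆ₙₐ[ℂ] D) (q₂ : C →⋆ₙₐ[ℂ] D) : Prop where
  equivariant_p₁ : IsEquivariant α β p₁
  equivariant_p₂ : IsEquivariant α γ p₂
  equivariant_q₁ : IsEquivariant β ε q₁
  equivariant_q₂ : IsEquivariant γ ε q₂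
  comm : ∀ a, q₁ (p₁ a) = q₂ (p₂ a)
  existsUnique : ∀ b c, q₁ b = q₂ c → ∃! a, p₁ a = b ∧ p₂ a = c

/-- `φ` is the quotient map by the closed two-sided ideal generated by `p`. -/
structure IsQuotientByIdeal {A B : Type*} [NonUnitalCStarAlgebra A] [NonUnitalCStarAlgebra B]
    (φ : A →⋆ₙₐ[ℂ] B) (p : A) : Prop where
  surjective : Function.Surjective φ
  ker_eq : {a | φ a = 0} = closure (TwoSidedIdeal.span {p} : Set A)

namespace DirectedGraph

variable {V E : Type*}

namespace CKFamily

variable {G : DirectedGraph V E} {B : Type*} [NonUnitalCStarAlgebra B] (F : CKFamily G B)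

/-- The Cuntz–Krieger family `P_v`, `z S_e`. -/
def rotate (z : Circle) : CKFamily G B where
  P := F.P
  S e := (z : ℂ) • F.S e
  isStarProjection := F.isStarProjection
  orthogonal := F.orthogonal
  partialIsometry e := by
    rw [star_smul, smul_mul_smul_comm, smul_mul_smul_comm, F.partialIsometry, Complex.star_def,
      Complex.mul_conj, Circle.normSq_coe, Complex.ofReal_one, one_mul]
  ck1 e := by
    simp [star_smul, smul_mul_smul_comm, F.ck1, ← Complex.normSq_eq_conj_mul_self]
  ck2 v t h hne := by
    simpa [star_smul, smul_mul_smul_comm, Complex.mul_conj] using F.ck2 v t h hne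

open CircleTensor in
/-- The Cuntz–Krieger family `P_v ⊗ 1`, `S_e ⊗ u`. -/
def tensorU : CKFamily G (CircleTensor B) where
  P v := elemTensor (F.P v) 1
  S e := elemTensor (F.S e) circleU
  isStarProjection v := by
    refine ⟨?_, ?_⟩
    · rw [IsIdempotentElem, elemTensor_mul, (F.isStarProjection v).isIdempotentElem.eq, one_mul]
    · rw [IsSelfAdjoint, star_elemTensor, (F.isStarProjection v).isSelfAdjoint.star_eq, star_one]
  orthogonal v w h := by rw [elemTensor_mul, F.orthogonal v w h, zero_elemTensor]
  partialIsometry e := by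
    rw [star_elemTensor, elemTensor_mul, elemTensor_mul, F.partialIsometry, circleU_mul_star,
      one_mul]
  ck1 e := by rw [star_elemTensor, elemTensor_mul, F.ck1, star_circleU_mul]
  ck2 v t h hne := by
    simp only [star_elemTensor, elemTensor_mul, circleU_mul_star]
    rw [← sum_elemTensor, F.ck2 v t h hne]

end CKFamily

variable (G : DirectedGraph V E)

/-- The gauge action of `U(1)` on `C*(G)`: it fixes `P_v` and sends `S_e` to `z S_e`. -/
def gaugeAction : CircleAction G.CStar where
  act z := CStar.lift ((CStar.family G).rotate z)
  act_one a := by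
    refine DFunLike.congr_fun (g := NonUnitalStarAlgHom.id ℂ G.CStar) (CStar.hom_ext ?_ ?_) a
    · intro v; simp [CKFamily.rotate]
    · intro e; simp [CKFamily.rotate]
  act_mul z w a := by
    refine DFunLike.congr_fun (g := (CStar.lift ((CStar.family G).rotate z)).comp
      (CStar.lift ((CStar.family G).rotate w))) (CStar.hom_ext ?_ ?_) a
    · intro v; simp [CKFamily.rotate]
    · intro e; simp [CKFamily.rotate, smul_smul, mul_comm]
  continuous a := by
    refine CStar.eq_top_of_isClosed G
      { carrier := {a | Continuous fun z => CStar.lift ((CStar.family G).rotate z) a}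
        zero_mem' := by simpa using continuous_const
        add_mem' := fun ha hb => by simp only [Set.mem_ofPred_eq, map_add]; exact Continuous.add ha hb
        mul_mem' := fun ha hb => by simp only [Set.mem_ofPred_eq, map_mul]; exact Continuous.mul ha hb
        smul_mem' := fun c a ha => by
          simp only [Set.mem_ofPred_eq, map_smul]; exact Continuous.const_smul ha c
        star_mem' := fun ha => by simpa [map_star] using Continuous.star ha }
      ?_ ?_ ?_ a
    · refine isClosed_of_closure_subset fun a ha => ?_
      refine continuous_of_uniform_approx_of_continuous fun U hU => ?_
      obtain ⟨ε, hε, hεU⟩ := Metric.mem_uniformity_dist.mp hU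
      obtain ⟨b, hb, hab⟩ := Metric.mem_closure_iff.mp ha ε hε
      refine ⟨_, hb, fun z => hεU ?_⟩
      rw [dist_eq_norm, ← map_sub]
      exact (NonUnitalStarAlgHom.norm_apply_le _ _).trans_lt (by rwa [← dist_eq_norm])
    · intro v
      change Continuous fun z => CStar.lift ((CStar.family G).rotate z) ((CStar.family G).P v)
      simpa [CKFamily.rotate] using continuous_const
    · intro e
      change Continuous fun z => CStar.lift ((CStar.family G).rotate z) ((CStar.family G).S e)
      simp only [CStar.lift_S, CKFamily.rotate]
      fun_prop

/-- The gauge coaction `δ`, with `δ P_v = P_v ⊗ 1` and `δ S_e = S_e ⊗ u`. -/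
def gaugeCoaction : G.CStar →⋆ₙₐ[ℂ] CircleTensor G.CStar :=
  CStar.lift (CStar.family G).tensorU

/-- The subgraph obtained by removing an edge. -/
def removeEdge (e₀ : E) : DirectedGraph V {e // e ≠ e₀} where
  src e := G.src e
  rng e := G.rng e

/-- The subgraph obtained by removing a vertex and all edges that begin or end in it. When all
edges beginning in `v₀` also end in `v₀`, this removes `v₀` and the edges that end in it. -/
def removeVertex (v₀ : V) :
    DirectedGraph {v // v ≠ v₀} {e // G.src e ≠ v₀ ∧ G.rng e ≠ v₀} where
  src e := ⟨G.src e, e.2.1⟩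
  rng e := ⟨G.rng e, e.2.2⟩

/-- The graph `G` (assumed finite where this is used) is `v₀`-trimmable, with loop `e₀`. -/
structure IsTrimmable (v₀ : V) (e₀ : E) : Prop where
  rng_loop : G.rng e₀ = v₀
  src_preimage : G.src ⁻¹' {v₀} = {e₀}
  nonempty : (G.rng ⁻¹' {v₀} \ {e₀}).Nonempty
  nonempty_of_mem : ∀ v ∈ G.src '' (G.rng ⁻¹' {v₀} \ {e₀}),
    (G.src ⁻¹' {v} \ G.rng ⁻¹' {v₀}).Nonempty

namespace IsTrimmable

variable {G} {v₀ : V} {e₀ : E}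

theorem src_eq_iff (h : G.IsTrimmable v₀ e₀) (e : E) : G.src e = v₀ ↔ e = e₀ := by
  simpa using Set.ext_iff.mp h.src_preimage e

open Classical in
/-- The image in `C*(G'')` of the Cuntz–Krieger family of `G`, where `G''` is `G` with `v₀`
removed: `P_{v₀}` and all `S_e` with `e` ending in `v₀` are sent to zero, the other generators to
themselves. -/
def quotientFamily (h : G.IsTrimmable v₀ e₀) :
    CKFamily G (G.removeVertex v₀).CStar where
  P v := if hv : v ≠ v₀ then (CStar.family (G.removeVertex v₀)).P ⟨v, hv⟩ else 0
  S e := if he : G.src e ≠ v₀ ∧ G.rng e ≠ v₀ then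
    (CStar.family (G.removeVertex v₀)).S ⟨e, he⟩ else 0
  isStarProjection v := by
    split_ifs
    · exact (CStar.family (G.removeVertex v₀)).isStarProjection _
    · exact IsStarProjection.zero _
  orthogonal v w hvw := by
    split_ifs
    · exact (CStar.family (G.removeVertex v₀)).orthogonal _ _ (by simpa using hvw)
    all_goals simp
  partialIsometry e := by
    split_ifs
    · exact (CStar.family (G.removeVertex v₀)).partialIsometry _
    · simp
  ck1 e := by
    by_cases hr : G.rng e ≠ v₀
    · have hs : G.src e ≠ v₀ := fun hs => hr (((h.src_eq_iff e).mp hs) ▸ h.rng_loop)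
      rw [dif_pos hr, dif_pos ⟨hs, hr⟩]
      exact (CStar.family (G.removeVertex v₀)).ck1 ⟨e, hs, hr⟩
    · rw [dif_neg hr, dif_neg fun h' => hr h'.2, mul_zero]
  ck2 v t ht hne := by
    by_cases hv : v ≠ v₀
    · rw [dif_pos hv]
      obtain ⟨e, he, her⟩ : ∃ e, G.src e = v ∧ G.rng e ≠ v₀ := by
        obtain ⟨e, he⟩ := hne
        have hes := (ht e).mp he
        by_cases her : G.rng e = v₀
        · obtain ⟨e', he', her'⟩ := h.nonempty_of_mem v
            ⟨e, ⟨her, fun hee => hv (hes ▸ (h.src_eq_iff e).mpr hee)⟩, hes⟩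
          exact ⟨e', he', her'⟩
        · exact ⟨e, hes, her⟩
      rw [← (CStar.family (G.removeVertex v₀)).ck2 ⟨v, hv⟩
        (t.subtype fun e => G.src e ≠ v₀ ∧ G.rng e ≠ v₀)
        (fun e => by
          rw [Finset.mem_subtype, ht]
          exact (Subtype.ext_iff (a1 := (G.removeVertex v₀).src e) (a2 := ⟨v, hv⟩)).symm)
        ⟨⟨e, he ▸ hv, her⟩, Finset.mem_subtype.mpr ((ht e).mpr he)⟩]
      rw [← Finset.sum_filter_of_ne (p := fun e => G.src e ≠ v₀ ∧ G.rng e ≠ v₀),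
        ← Finset.sum_subtype_eq_sum_filter]
      · exact Finset.sum_congr rfl fun e _ => by rw [dif_pos e.2]
      · intro e _ hne
        by_contra hc
        exact hne (by rw [dif_neg hc, zero_mul])
    · rw [dif_neg hv]
      refine Finset.sum_eq_zero fun e he => ?_
      rw [dif_neg fun h' => hv (((ht e).mp he) ▸ h'.1), zero_mul]

/-- The image in `C*(G'')` of the Cuntz–Krieger family of `G'`, which is `G` without its loop. -/
def quotientFamily' (h : G.IsTrimmable v₀ e₀) :
    CKFamily (G.removeEdge e₀) (G.removeVertex v₀).CStar where
  P := h.quotientFamily.P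
  S e := h.quotientFamily.S e
  isStarProjection := h.quotientFamily.isStarProjection
  orthogonal := h.quotientFamily.orthogonal
  partialIsometry e := h.quotientFamily.partialIsometry e
  ck1 e := h.quotientFamily.ck1 e
  ck2 v t ht hne := by
    obtain ⟨e, he⟩ := hne
    have hv : v ≠ v₀ := fun hv => e.2 ((h.src_eq_iff e).mp (((ht e).mp he).trans hv))
    rw [← h.quotientFamily.ck2 v (t.map (Function.Embedding.subtype _)) (fun e' => ?_)
      ⟨e, by simpa using ⟨e.2, he⟩⟩, Finset.sum_map]
    · rfl
    · constructor
      · intro he'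
        obtain ⟨e'', he'', rfl⟩ := Finset.mem_map.mp he'
        exact (ht e'').mp he''
      · intro he'
        have hne : e' ≠ e₀ := fun hc => hv (he' ▸ (h.src_eq_iff e').mpr hc)
        exact Finset.mem_map.mpr ⟨⟨e', hne⟩, (ht ⟨e', hne⟩).mpr he', rfl⟩

/-- The quotient map `π₁ : C*(G) → C*(G'')`. -/
def quotientMap (h : G.IsTrimmable v₀ e₀) :
    G.CStar →⋆ₙₐ[ℂ] (G.removeVertex v₀).CStar :=
  CStar.lift h.quotientFamily

/-- The quotient map `π₂ : C*(G') → C*(G'')`. -/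
def quotientMap' (h : G.IsTrimmable v₀ e₀) :
    (G.removeEdge e₀).CStar →⋆ₙₐ[ℂ] (G.removeVertex v₀).CStar :=
  CStar.lift h.quotientFamily'

open Classical CircleTensor in
/-- The Cuntz–Krieger family in `C*(G') ⊗ C(S¹)` that defines `f`. -/
def tensorFamily (h : G.IsTrimmable v₀ e₀) :
    CKFamily G (CircleTensor (G.removeEdge e₀).CStar) where
  P v := elemTensor ((CStar.family (G.removeEdge e₀)).P v) 1
  S e := if he : e = e₀ then elemTensor ((CStar.family (G.removeEdge e₀)).P v₀) circleU
    else elemTensor ((CStar.family (G.removeEdge e₀)).S ⟨e, he⟩) circleU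
  isStarProjection := (CStar.family (G.removeEdge e₀)).tensorU.isStarProjection
  orthogonal := (CStar.family (G.removeEdge e₀)).tensorU.orthogonal
  partialIsometry e := by
    split_ifs with he
    · have hP := (CStar.family (G.removeEdge e₀)).isStarProjection v₀
      rw [star_elemTensor, hP.isSelfAdjoint.star_eq, elemTensor_mul, elemTensor_mul,
        hP.isIdempotentElem.eq, hP.isIdempotentElem.eq, circleU_mul_star, one_mul]
    · exact (CStar.family (G.removeEdge e₀)).tensorU.partialIsometry ⟨e, he⟩
  ck1 e := by
    split_ifs with he
    · have hP := (CStar.family (G.removeEdge e₀)).isStarProjection v₀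
      rw [star_elemTensor, hP.isSelfAdjoint.star_eq, elemTensor_mul,
        hP.isIdempotentElem.eq, star_circleU_mul, he, h.rng_loop]
    · exact (CStar.family (G.removeEdge e₀)).tensorU.ck1 ⟨e, he⟩
  ck2 v t ht hne := by
    by_cases hv : v = v₀
    · have ht' : t = {e₀} := by
        ext e
        rw [ht, hv, h.src_eq_iff, Finset.mem_singleton]
      have hP := (CStar.family (G.removeEdge e₀)).isStarProjection v₀
      rw [ht', Finset.sum_singleton, dif_pos rfl, star_elemTensor, hP.isSelfAdjoint.star_eq,
        elemTensor_mul, hP.isIdempotentElem.eq, circleU_mul_star, hv]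
    · have hmem : ∀ e ∈ t, e ≠ e₀ := fun e he hc =>
        hv (((ht e).mp he).symm.trans ((h.src_eq_iff e).mpr hc))
      obtain ⟨e, he⟩ := hne
      refine Eq.trans ?_ ((CStar.family (G.removeEdge e₀)).tensorU.ck2 v
        (t.subtype fun e => e ≠ e₀) (fun e => by rw [Finset.mem_subtype, ht]; rfl)
        ⟨⟨e, hmem e he⟩, Finset.mem_subtype.mpr he⟩)
      rw [← Finset.sum_filter_of_ne (p := fun e => e ≠ e₀) (fun e he _ => hmem e he),
        ← Finset.sum_subtype_eq_sum_filter]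
      exact Finset.sum_congr rfl fun e _ => by rw [dif_neg e.2]; rfl

/-- The homomorphism `f : C*(G) → C*(G') ⊗ C(S¹)`, with `f P_v = P_v ⊗ 1`,
`f S_{e₀} = P_{v₀} ⊗ u`, and `f S_e = S_e ⊗ u` for `e ≠ e₀`. -/
def tensorMap (h : G.IsTrimmable v₀ e₀) :
    G.CStar →⋆ₙₐ[ℂ] CircleTensor (G.removeEdge e₀).CStar :=
  CStar.lift h.tensorFamily

end IsTrimmable

end DirectedGraph

end

/-!
Write `P` for the projection at `v₀`, `S` for the partial isometry of the loop `e₀`, `A = C*(G)`,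
`A' = C*(G')` and `A'' = C*(G'')`, where `G'` is `G` without the loop and `G''` is `G` without `v₀`.

*Kernels.* Modulo the closed ideal `I` generated by `P`, all `S_e = S_e P_{r(e)}` with `r(e) = v₀`
vanish, so that the remaining generators form a Cuntz–Krieger family of `G''` in `A / I`. The
resulting homomorphism `A'' → A / I` inverts the map induced by `π₁`
(`ClosedStarIdeal.isQuotientByIdeal_of_inverse`), and likewise for `π₂`. This needs `A / I` to be a
`C*`-algebra, which follows from the existence of approximate units in `I`
(`ClosedStarIdeal.Quot.norm_mul_self_le`).

*Injectivity.* Since `e₀` is the only edge emitted by `v₀`, the operator `S` is a unitary in the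
corner `P A P` and generates it (`IsTrimmable.corner_subset_closure`). The homomorphism `f` maps a
continuous function `g` of `S` to `P ⊗ g`, and is therefore isometric on the corner
(`IsTrimmable.eq_zero_of_tensorMap_corner_eq_zero`). By a `C*`-identity argument it is then
injective on all of `I = ker π₁` (`IsTrimmable.eq_zero_of_tensorMap_eq_zero`).

*Surjectivity.* It suffices that `f(I)` contains `ker (π₂ ⊗ id) = C(S¹, I')`, where `I'` is the
closed ideal of `A'` generated by `P`. As `f` is isometric on `I`, the image `f(I)` is closed. It
contains `P ⊗ uⁿ` for all integers `n`, and it is invariant under multiplication by the elements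
`f(S_e) = S_e ⊗ u`; a power of `u` can be absorbed in the second tensor factor, so the elements `x`
with `x ⊗ C(S¹) ⊆ f(I)` form a closed ideal of `A'`
(`IsTrimmable.elemTensor_mem_tensorMap_image`).

Paths in the graph are avoided by a simple device: a closed subspace that is invariant under left
multiplication by the generators and their adjoints is a left ideal
(`CStar.mul_mem_of_isClosed`), because its multipliers form a closed `*`-subalgebra.
-/

noncomputable section

/-! ### Quotients of `C*`-algebras by closed ideals -/

/-- A closed self-adjoint left ideal of a `C*`-algebra `A`, hence a closed two-sided ideal, bundled
with its structure of a `*`-subalgebra. -/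
structure ClosedStarIdeal (A : Type*) [NonUnitalCStarAlgebra A] extends
    NonUnitalStarSubalgebra ℂ A where
  isClosed' : IsClosed carrier
  mul_mem_left' : ∀ (a : A) {x : A}, x ∈ carrier → a * x ∈ carrier

namespace ClosedStarIdeal

variable {A : Type*} [NonUnitalCStarAlgebra A] (I : ClosedStarIdeal A)

theorem mul_mem_left (a : A) {x : A} (hx : x ∈ I.toNonUnitalStarSubalgebra) :
    a * x ∈ I.toNonUnitalStarSubalgebra :=
  I.mul_mem_left' a hx

theorem mul_mem_right (a : A) {x : A} (hx : x ∈ I.toNonUnitalStarSubalgebra) :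
    x * a ∈ I.toNonUnitalStarSubalgebra := by
  simpa using star_mem (I.mul_mem_left (star a) (star_mem hx))

instance : IsClosed (I.toNonUnitalStarSubalgebra : Set A) := I.isClosed'

/-- The underlying complex subspace of a closed ideal. -/
abbrev subspace : Submodule ℂ A := I.toNonUnitalSubalgebra.toSubmodule

instance : IsClosed (I.subspace : Set A) := I.isClosed'

/-- An element `j` of a closed ideal is almost fixed by right multiplication with some self-adjoint
element `e` of the ideal for which `1 - e` is a contraction in the unitization of the algebra. -/
theorem exists_approx_unit {j : A} (hj : j ∈ I.toNonUnitalStarSubalgebra) {ε : ℝ} (hε : 0 < ε) :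
    ∃ e ∈ I.toNonUnitalStarSubalgebra, IsSelfAdjoint e ∧
      ‖(1 : Unitization ℂ A) - (e : Unitization ℂ A)‖ ≤ 1 ∧ ‖j - j * e‖ < ε := by
  let J := I.toNonUnitalStarSubalgebra
  let _ : PartialOrder J := CStarAlgebra.spectralOrder J
  have : StarOrderedRing J := CStarAlgebra.spectralOrderedRing J
  let _ : PartialOrder (Unitization ℂ A) := CStarAlgebra.spectralOrder _
  have : StarOrderedRing (Unitization ℂ A) := CStarAlgebra.spectralOrderedRing _
  have hl := CStarAlgebra.increasingApproximateUnit J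
  have := hl.neBot
  have h1 := hl.tendsto_mul_left (⟨j, hj⟩ : J)
  have h2 : ∀ᶠ x in CStarAlgebra.approximateUnit J, ‖(⟨j, hj⟩ : J) - ⟨j, hj⟩ * x‖ < ε := by
    filter_upwards [h1.eventually (Metric.ball_mem_nhds _ hε)] with x hx
    rwa [dist_comm, dist_eq_norm] at hx
  obtain ⟨e, he1, he2, he3⟩ := (h2.and (hl.eventually_nonneg.and hl.eventually_norm)).exists
  refine ⟨e, e.2, congrArg Subtype.val he2.isSelfAdjoint, ?_, he1⟩
  let φ : J →⋆ₙₐ[ℂ] Unitization ℂ A :=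
    (Unitization.inrNonUnitalStarAlgHom ℂ A).comp (NonUnitalStarSubalgebraClass.subtype J)
  have h0 : 0 ≤ φ e := map_nonneg φ he2
  have hn : ‖φ e‖ ≤ 1 := (NonUnitalStarAlgHom.norm_apply_le φ e).trans he3
  have hle : φ e ≤ 1 := (CStarAlgebra.norm_le_one_iff_of_nonneg (φ e) h0).mp hn
  exact (CStarAlgebra.norm_le_one_iff_of_nonneg (1 - φ e) (sub_nonneg.mpr hle)).mpr
    (sub_le_self 1 h0)

/-- The quotient of a `C*`-algebra by a closed ideal. -/
def Quot : Type _ := A ⧸ I.subspace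

namespace Quot

instance : NormedAddCommGroup I.Quot := inferInstanceAs (NormedAddCommGroup (A ⧸ I.subspace))
instance : NormedSpace ℂ I.Quot := inferInstanceAs (NormedSpace ℂ (A ⧸ I.subspace))
instance : CompleteSpace I.Quot := inferInstanceAs (CompleteSpace (A ⧸ I.subspace))

/-- The class of an element in the quotient by a closed ideal. -/
def mk : A →ₗ[ℂ] I.Quot := I.subspace.mkQ

theorem mk_surjective : Function.Surjective (mk I) := I.subspace.mkQ_surjective

theorem mk_eq_zero {a : A} : mk I a = 0 ↔ a ∈ I.toNonUnitalStarSubalgebra :=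
  Submodule.Quotient.mk_eq_zero _

theorem mk_eq_mk {a b : A} : mk I a = mk I b ↔ a - b ∈ I.toNonUnitalStarSubalgebra := by
  rw [← mk_eq_zero, map_sub, sub_eq_zero]

theorem norm_mk_le (a : A) : ‖mk I a‖ ≤ ‖a‖ := Submodule.Quotient.norm_mk_le (S := I.subspace) a

theorem norm_mk_add_le (a : A) {x : A} (hx : x ∈ I.toNonUnitalStarSubalgebra) :
    ‖mk I a‖ ≤ ‖a + x‖ := by
  have h : mk I (a + x) = mk I a := by rw [map_add, (mk_eq_zero I).mpr hx, add_zero]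
  exact h ▸ norm_mk_le I (a + x)

theorem exists_norm_lt (x : I.Quot) {ε : ℝ} (hε : 0 < ε) : ∃ a, mk I a = x ∧ ‖a‖ < ‖x‖ + ε :=
  Submodule.Quotient.norm_mk_lt (S := I.subspace) x hε

/-- A representative of a class. -/
def out : I.Quot → A := Function.surjInv (mk_surjective I)

theorem mk_out (x : I.Quot) : mk I (out I x) = x := Function.surjInv_eq (mk_surjective I) x

-- products and adjoints are formed with chosen representatives; by `mk_mul` and `mk_star` the
-- choice does not matter
instance : Mul I.Quot := ⟨fun x y => mk I (out I x * out I y)⟩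
instance : Star I.Quot := ⟨fun x => mk I (star (out I x))⟩

theorem mk_mul (a b : A) : mk I (a * b) = mk I a * mk I b := by
  change _ = mk I (out I (mk I a) * out I (mk I b))
  have ha := (mk_eq_mk I).mp (mk_out I (mk I a)).symm
  have hb := (mk_eq_mk I).mp (mk_out I (mk I b)).symm
  rw [mk_eq_mk]
  have : a * b - out I (mk I a) * out I (mk I b) =
      a * (b - out I (mk I b)) + (a - out I (mk I a)) * out I (mk I b) := by noncomm_ring
  rw [this]
  exact add_mem (I.mul_mem_left _ hb) (I.mul_mem_right _ ha)

theorem mk_star (a : A) : mk I (star a) = star (mk I a) := by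
  change _ = mk I (star (out I (mk I a)))
  rw [mk_eq_mk, ← star_sub]
  exact star_mem ((mk_eq_mk I).mp (mk_out I (mk I a)).symm)

instance : NonUnitalRing I.Quot where
  left_distrib x y z := by
    obtain ⟨a, rfl⟩ := mk_surjective I x
    obtain ⟨b, rfl⟩ := mk_surjective I y
    obtain ⟨c, rfl⟩ := mk_surjective I z
    simp only [← mk_mul, ← map_add, mul_add]
  right_distrib x y z := by
    obtain ⟨a, rfl⟩ := mk_surjective I x
    obtain ⟨b, rfl⟩ := mk_surjective I y
    obtain ⟨c, rfl⟩ := mk_surjective I z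
    simp only [← mk_mul, ← map_add, add_mul]
  zero_mul x := by
    obtain ⟨a, rfl⟩ := mk_surjective I x
    rw [← map_zero (mk I), ← mk_mul, zero_mul]
  mul_zero x := by
    obtain ⟨a, rfl⟩ := mk_surjective I x
    rw [← map_zero (mk I), ← mk_mul, mul_zero]
  mul_assoc x y z := by
    obtain ⟨a, rfl⟩ := mk_surjective I x
    obtain ⟨b, rfl⟩ := mk_surjective I y
    obtain ⟨c, rfl⟩ := mk_surjective I z
    simp only [← mk_mul, mul_assoc]

theorem norm_mul_le' (x y : I.Quot) : ‖x * y‖ ≤ ‖x‖ * ‖y‖ := by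
  have h : ∀ ε : ℝ, 0 < ε → ‖x * y‖ ≤ (‖x‖ + ε) * (‖y‖ + ε) := fun ε hε => by
    obtain ⟨a, ha, ha'⟩ := exists_norm_lt I x hε
    obtain ⟨b, hb, hb'⟩ := exists_norm_lt I y hε
    calc ‖x * y‖ = ‖mk I (a * b)‖ := by rw [mk_mul, ha, hb]
      _ ≤ ‖a‖ * ‖b‖ := (norm_mk_le I _).trans (norm_mul_le a b)
      _ ≤ _ := by gcongr
  refine ge_of_tendsto (f := fun ε : ℝ => (‖x‖ + ε) * (‖y‖ + ε)) (x := nhdsWithin 0 (Set.Ioi 0))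
    ?_ (eventually_nhdsWithin_of_forall h)
  have : Continuous fun ε : ℝ => (‖x‖ + ε) * (‖y‖ + ε) := by fun_prop
  simpa using (this.tendsto 0).mono_left nhdsWithin_le_nhds

instance : NonUnitalNormedRing I.Quot where
  dist_eq := NormedAddGroup.dist_eq
  norm_mul_le := norm_mul_le' I

instance : StarRing I.Quot where
  star_involutive x := by
    obtain ⟨a, rfl⟩ := mk_surjective I x
    simp only [← mk_star, star_star]
  star_mul x y := by
    obtain ⟨a, rfl⟩ := mk_surjective I x
    obtain ⟨b, rfl⟩ := mk_surjective I y
    simp only [← mk_star, ← mk_mul, star_mul]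
  star_add x y := by
    obtain ⟨a, rfl⟩ := mk_surjective I x
    obtain ⟨b, rfl⟩ := mk_surjective I y
    simp only [← mk_star, ← map_add, star_add]

/-- The quotient norm satisfies the `C*`-identity: if `b = a* a - j` has nearly the
norm of the class of `a* a` and `e` in the ideal almost fixes `j`, then `a - a e` is a
representative of the class of `a` with
`‖a - a e‖² = ‖(1 - e) (b + j) (1 - e)‖ ≤ ‖b‖ + ‖j (1 - e)‖`. -/
theorem norm_mul_self_le (x : I.Quot) : ‖x‖ * ‖x‖ ≤ ‖star x * x‖ := by
  obtain ⟨a, rfl⟩ := mk_surjective I x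
  refine le_of_forall_pos_le_add fun ε hε => ?_
  obtain ⟨b, hb, hb'⟩ := exists_norm_lt I (star (mk I a) * mk I a) (half_pos (half_pos hε))
  rw [eq_comm, ← mk_star, ← mk_mul, mk_eq_mk] at hb
  obtain ⟨e, he, hsa, he1, hje⟩ := I.exists_approx_unit hb (half_pos (half_pos hε))
  let d : Unitization ℂ A := 1 - (e : Unitization ℂ A)
  have hd : star d = d := by
    simp only [d, star_sub, star_one, ← Unitization.inr_star, hsa.star_eq]
  have hnorm : ∀ x : A, ‖x‖ = ‖(x : Unitization ℂ A)‖ := fun x => (Unitization.norm_inr x).symm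
  have key : ((a - a * e : A) : Unitization ℂ A) = (a : Unitization ℂ A) * d := by
    simp [d, mul_sub]
  set j := star a * a - b with hj
  have h1 : ‖mk I a‖ ≤ ‖(a : Unitization ℂ A) * d‖ := by
    rw [← key, ← hnorm, sub_eq_add_neg]
    exact norm_mk_add_le I a (neg_mem (I.mul_mem_left a he))
  have h2 : star ((a : Unitization ℂ A) * d) * ((a : Unitization ℂ A) * d) =
      d * (b : Unitization ℂ A) * d + d * ((j - j * e : A) : Unitization ℂ A) := by
    have : (b : Unitization ℂ A) = star (a : Unitization ℂ A) * a - j := by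
      rw [← Unitization.inr_star, ← Unitization.inr_mul, ← Unitization.inr_sub, hj, sub_sub_cancel]
    have h3 : ((j - j * e : A) : Unitization ℂ A) = (j : Unitization ℂ A) * d := by
      simp [d, mul_sub]
    rw [this, h3, star_mul, hd]
    noncomm_ring
  have h4 : ‖d * (b : Unitization ℂ A) * d‖ ≤ ‖b‖ := by
    calc _ ≤ ‖d‖ * ‖(b : Unitization ℂ A)‖ * ‖d‖ :=
          (norm_mul_le _ _).trans (mul_le_mul_of_nonneg_right (norm_mul_le _ _) (norm_nonneg _))
      _ ≤ 1 * ‖(b : Unitization ℂ A)‖ * 1 := by gcongr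
      _ = ‖b‖ := by rw [one_mul, mul_one, hnorm]
  have h5 : ‖d * ((j - j * e : A) : Unitization ℂ A)‖ ≤ ε / 2 / 2 := by
    calc _ ≤ ‖d‖ * ‖((j - j * e : A) : Unitization ℂ A)‖ := norm_mul_le _ _
      _ ≤ 1 * ‖((j - j * e : A) : Unitization ℂ A)‖ := by gcongr
      _ ≤ _ := by rw [one_mul, ← hnorm]; exact hje.le
  calc ‖mk I a‖ * ‖mk I a‖ ≤ ‖(a : Unitization ℂ A) * d‖ * ‖(a : Unitization ℂ A) * d‖ := by gcongr
    _ = ‖d * (b : Unitization ℂ A) * d + d * ((j - j * e : A) : Unitization ℂ A)‖ := by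
      rw [← CStarRing.norm_star_mul_self, h2]
    _ ≤ ‖b‖ + ε / 2 / 2 := (norm_add_le _ _).trans (add_le_add h4 h5)
    _ ≤ ‖star (mk I a) * mk I a‖ + ε := by linarith

instance : NonUnitalCStarAlgebra I.Quot where
  norm_mul_self_le := norm_mul_self_le I
  smul_assoc c x y := by
    obtain ⟨a, rfl⟩ := mk_surjective I x
    obtain ⟨b, rfl⟩ := mk_surjective I y
    simp only [smul_eq_mul, ← map_smul, ← mk_mul, smul_mul_assoc]
  smul_comm c x y := by
    obtain ⟨a, rfl⟩ := mk_surjective I x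
    obtain ⟨b, rfl⟩ := mk_surjective I y
    simp only [smul_eq_mul, ← map_smul, ← mk_mul, mul_smul_comm]
  star_smul c x := by
    obtain ⟨a, rfl⟩ := mk_surjective I x
    simp only [← map_smul, ← mk_star, star_smul]

/-- The quotient map as a `*`-homomorphism. -/
def mkHom : A →⋆ₙₐ[ℂ] I.Quot where
  toFun := mk I
  map_smul' := map_smul (mk I)
  map_zero' := map_zero (mk I)
  map_add' := map_add (mk I)
  map_mul' := mk_mul I
  map_star' := mk_star I

theorem mkHom_apply (a : A) : mkHom I a = mk I a := rfl

/-- A `*`-homomorphism that vanishes on a closed ideal factors through the quotient. -/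
def liftHom {B : Type*} [NonUnitalCStarAlgebra B] (φ : A →⋆ₙₐ[ℂ] B)
    (hφ : ∀ x ∈ I.toNonUnitalStarSubalgebra, φ x = 0) : I.Quot →⋆ₙₐ[ℂ] B :=
  have h : ∀ a, φ (out I (mk I a)) = φ a := fun a => by
    rw [← sub_eq_zero, ← map_sub]
    exact hφ _ ((mk_eq_mk I).mp (mk_out I _))
  { toFun := fun x => φ (out I x)
    map_smul' := fun c x => by
      obtain ⟨a, rfl⟩ := mk_surjective I x
      rw [← map_smul, h, h, map_smul]; rfl
    map_zero' := by rw [← map_zero (mk I), h, map_zero]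
    map_add' := fun x y => by
      obtain ⟨a, rfl⟩ := mk_surjective I x
      obtain ⟨b, rfl⟩ := mk_surjective I y
      rw [← map_add, h, h, h, map_add]
    map_mul' := fun x y => by
      obtain ⟨a, rfl⟩ := mk_surjective I x
      obtain ⟨b, rfl⟩ := mk_surjective I y
      rw [← mk_mul, h, h, h, map_mul]
    map_star' := fun x => by
      obtain ⟨a, rfl⟩ := mk_surjective I x
      rw [← mk_star, h, h, map_star] }

theorem liftHom_mkHom {B : Type*} [NonUnitalCStarAlgebra B] (φ : A →⋆ₙₐ[ℂ] B)
    (hφ : ∀ x ∈ I.toNonUnitalStarSubalgebra, φ x = 0) (a : A) :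
    liftHom I φ hφ (mkHom I a) = φ a := by
  change φ (out I (mk I a)) = φ a
  rw [← sub_eq_zero, ← map_sub]
  exact hφ _ ((mk_eq_mk I).mp (mk_out I _))

end Quot

/-- The closure of the ideal generated by a projection, as a closed `*`-ideal. -/
def ofProjection {p : A} (hp : IsStarProjection p) : ClosedStarIdeal A :=
  have hstar : ∀ x ∈ TwoSidedIdeal.span {p}, star x ∈ TwoSidedIdeal.span {p} := fun x hx => by
    induction hx using TwoSidedIdeal.span_induction with
    | mem x hx =>
      rw [Set.mem_singleton_iff.mp hx, hp.isSelfAdjoint.star_eq]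
      exact TwoSidedIdeal.subset_span rfl
    | zero => simp
    | add x y _ _ hx hy => rw [star_add]; exact add_mem hx hy
    | neg x _ hx => rw [star_neg]; exact neg_mem hx
    | left_absorb a x _ hx => rw [star_mul]; exact TwoSidedIdeal.mul_mem_right _ _ _ hx
    | right_absorb b x _ hx => rw [star_mul]; exact TwoSidedIdeal.mul_mem_left _ _ _ hx
  -- `A` may lack a unit, so that complex multiples are absorbed only because `p = p * p`
  have hsmul : ∀ (c : ℂ), ∀ x ∈ TwoSidedIdeal.span {p}, c • x ∈ TwoSidedIdeal.span {p} :=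
    fun c x hx => by
      induction hx using TwoSidedIdeal.span_induction with
      | mem x hx =>
        rw [Set.mem_singleton_iff.mp hx, ← hp.isIdempotentElem.eq, ← smul_mul_assoc]
        exact TwoSidedIdeal.mul_mem_left _ _ _ (TwoSidedIdeal.subset_span (by
          rw [hp.isIdempotentElem.eq]; rfl))
      | zero => simp
      | add x y _ _ hx hy => rw [smul_add]; exact add_mem hx hy
      | neg x _ hx => rw [smul_neg]; exact neg_mem hx
      | left_absorb a x _ hx =>
        rw [← mul_smul_comm]; exact TwoSidedIdeal.mul_mem_left _ _ _ hx
      | right_absorb b x _ hx =>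
        rw [← smul_mul_assoc]; exact TwoSidedIdeal.mul_mem_right _ _ _ hx
  have hmul : ∀ (a : A), ∀ x ∈ closure (TwoSidedIdeal.span {p} : Set A),
      a * x ∈ closure (TwoSidedIdeal.span {p} : Set A) := fun a x hx =>
    map_mem_closure (continuous_const_mul a) hx fun y hy => TwoSidedIdeal.mul_mem_left _ _ _ hy
  { carrier := closure (TwoSidedIdeal.span {p} : Set A)
    zero_mem' := subset_closure (zero_mem _)
    add_mem' := fun hx hy => map_mem_closure₂ continuous_add hx hy fun _ hx _ hy => add_mem hx hy
    mul_mem' := fun {x _} _ hy => hmul x _ hy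
    smul_mem' := fun c _ hx => map_mem_closure (continuous_const_smul c) hx (hsmul c)
    star_mem' := fun hx => map_mem_closure continuous_star hx hstar
    isClosed' := isClosed_closure
    mul_mem_left' := fun a _ hx => hmul a _ hx }

variable {p : A} (hp : IsStarProjection p)

theorem mem_ofProjection {x : A} : x ∈ (ofProjection hp).toNonUnitalStarSubalgebra ↔
    x ∈ closure (TwoSidedIdeal.span {p} : Set A) := Iff.rfl

theorem self_mem_ofProjection : p ∈ (ofProjection hp).toNonUnitalStarSubalgebra :=
  subset_closure (TwoSidedIdeal.subset_span rfl)

/-- The ideal generated by a projection is contained in every closed two-sided ideal that contains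
the projection. -/
theorem ofProjection_subset {N : Set A} (hN : IsClosed N) (hpN : p ∈ N) (h0 : (0 : A) ∈ N)
    (hadd : ∀ {x y}, x ∈ N → y ∈ N → x + y ∈ N) (hneg : ∀ {x}, x ∈ N → -x ∈ N)
    (hl : ∀ {a x}, x ∈ N → a * x ∈ N) (hr : ∀ {x a}, x ∈ N → x * a ∈ N)
    {x : A} (hx : x ∈ (ofProjection hp).toNonUnitalStarSubalgebra) : x ∈ N := by
  have hle : TwoSidedIdeal.span {p} ≤ TwoSidedIdeal.mk' N h0 hadd hneg hl hr := by
    rw [TwoSidedIdeal.span_le, Set.singleton_subset_iff]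
    exact (TwoSidedIdeal.mem_mk' N h0 hadd hneg hl hr p).mpr hpN
  refine closure_minimal (fun y hy => ?_) hN hx
  exact (TwoSidedIdeal.mem_mk' N h0 hadd hneg hl hr y).mp (hle hy)

theorem map_eq_zero_of_mem_ofProjection {B : Type*} [NonUnitalCStarAlgebra B] {φ : A →⋆ₙₐ[ℂ] B}
    (hφ : φ p = 0) {x : A} (hx : x ∈ (ofProjection hp).toNonUnitalStarSubalgebra) : φ x = 0 := by
  refine ofProjection_subset hp (N := {x | φ x = 0})
    (isClosed_eq (DirectedGraph.CStar.continuous_hom φ) continuous_const) hφ (map_zero φ)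
    ?_ ?_ ?_ ?_ hx
  · intro x y (hx : φ x = 0) (hy : φ y = 0)
    simp [hx, hy]
  · intro x (hx : φ x = 0)
    simp [hx]
  · intro a x (hx : φ x = 0)
    simp [hx]
  · intro x a (hx : φ x = 0)
    simp [hx]

/-- A `*`-homomorphism `φ : A → B` is the quotient map by the ideal generated by `p` as soon as it
vanishes at `p` and there is a `*`-homomorphism in the other direction, from `B` to the quotient,
that inverts the map induced by `φ`. -/
theorem isQuotientByIdeal_of_inverse {B : Type*} [NonUnitalCStarAlgebra B] {φ : A →⋆ₙₐ[ℂ] B}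
    (hφ : φ p = 0) (ψ : B →⋆ₙₐ[ℂ] (ofProjection hp).Quot)
    (h1 : ∀ a, ψ (φ a) = Quot.mkHom _ a)
    (h2 : ∀ b, Quot.liftHom _ φ (fun _ => map_eq_zero_of_mem_ofProjection hp hφ) (ψ b) = b) :
    IsQuotientByIdeal φ p where
  surjective b := by
    obtain ⟨a, ha⟩ := Quot.mk_surjective _ (ψ b)
    refine ⟨a, ?_⟩
    rw [← h2 b, ← ha, ← Quot.mkHom_apply, Quot.liftHom_mkHom]
  ker_eq := by
    ext a
    refine ⟨fun (ha : φ a = 0) => ?_, map_eq_zero_of_mem_ofProjection hp hφ⟩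
    rw [← mem_ofProjection hp, ← Quot.mk_eq_zero, ← Quot.mkHom_apply, ← h1, ha, map_zero]
end ClosedStarIdeal

/-! ### Elementary tensors -/

namespace CircleTensor

variable {A : Type*} [NonUnitalCStarAlgebra A]

theorem add_elemTensor (a b : A) (g : C(Circle, ℂ)) :
    elemTensor (a + b) g = elemTensor a g + elemTensor b g := by
  ext z
  simp

theorem smul_elemTensor (c : ℂ) (a : A) (g : C(Circle, ℂ)) :
    elemTensor (c • a) g = c • elemTensor a g := by
  ext z
  simp [smul_comm c]

theorem elemTensor_zero (a : A) : elemTensor a 0 = 0 := by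
  ext z
  simp

theorem elemTensor_add (a : A) (g g' : C(Circle, ℂ)) :
    elemTensor a (g + g') = elemTensor a g + elemTensor a g' := by
  ext z
  simp [add_smul]

theorem elemTensor_smul (c : ℂ) (a : A) (g : C(Circle, ℂ)) :
    elemTensor a (c • g) = c • elemTensor a g := by
  ext z
  simp [mul_smul]

theorem continuous_elemTensor :
    Continuous fun x : A × C(Circle, ℂ) => elemTensor x.1 x.2 := by
  refine ContinuousMap.continuous_of_continuous_uncurry _ ?_
  change Continuous fun y : (A × C(Circle, ℂ)) × Circle => y.1.2 y.2 • y.1.1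
  fun_prop

theorem continuous_elemTensor_left (g : C(Circle, ℂ)) : Continuous fun a : A => elemTensor a g :=
  continuous_elemTensor.comp (Continuous.prodMk_left g)

theorem continuous_elemTensor_right (a : A) : Continuous fun g => elemTensor a g :=
  continuous_elemTensor.comp (Continuous.prodMk_right a)

end CircleTensor

theorem rotationAction_elemTensor_circleU {A : Type*} [NonUnitalCStarAlgebra A] (z : Circle)
    (a : A) : (rotationAction A).act z (elemTensor a circleU) = (z : ℂ) • elemTensor a circleU := by
  ext w
  change ((z * w : Circle) : ℂ) • a = (z : ℂ) • (w : ℂ) • a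
  rw [smul_smul, Circle.coe_mul]

/-! ### Cuntz–Krieger families under removal of a vertex or an edge -/

namespace DirectedGraph

variable {V E : Type*} {G : DirectedGraph V E}

namespace CKFamily

variable {B C : Type*} [NonUnitalCStarAlgebra B] [NonUnitalCStarAlgebra C]

theorem S_mul_P (F : CKFamily G B) (e : E) : F.S e * F.P (G.rng e) = F.S e := by
  rw [← F.ck1, ← mul_assoc, F.partialIsometry]

theorem S_eq_zero {F : CKFamily G B} {e : E} (h : F.P (G.rng e) = 0) : F.S e = 0 := by
  rw [← F.S_mul_P, h, mul_zero]

/-- The image of a Cuntz–Krieger family under a `*`-homomorphism. -/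
def map (F : CKFamily G B) (φ : B →⋆ₙₐ[ℂ] C) : CKFamily G C where
  P v := φ (F.P v)
  S e := φ (F.S e)
  isStarProjection v := (F.isStarProjection v).map φ
  orthogonal v w h := by rw [← map_mul, F.orthogonal v w h, map_zero]
  partialIsometry e := by rw [← map_star, ← map_mul, ← map_mul, F.partialIsometry]
  ck1 e := by rw [← map_star, ← map_mul, F.ck1]
  ck2 v t h hne := by
    simp only [← map_star, ← map_mul, ← map_sum]
    rw [F.ck2 v t h hne]

/-- A Cuntz–Krieger family of a finite graph whose projection at a vertex vanishes restricts to the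
graph with that vertex removed, because `S_e = S_e P_{r(e)}` vanishes for all edges `e` that end in
the vertex. -/
def removeVertex [Finite E] {v₀ : V} (F : CKFamily G B) (h₀ : F.P v₀ = 0) :
    CKFamily (G.removeVertex v₀) B where
  P v := F.P v
  S e := F.S e
  isStarProjection v := F.isStarProjection v
  orthogonal v w h := F.orthogonal v w (Subtype.coe_injective.ne h)
  partialIsometry e := F.partialIsometry e
  ck1 e := F.ck1 e
  ck2 v t ht hne := by
    classical
    cases nonempty_fintype E
    obtain ⟨e, he⟩ := hne
    have hsrc : ∀ e ∈ t, G.src e = v := fun e he => congrArg Subtype.val ((ht e).mp he)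
    rw [← F.ck2 v (Finset.univ.filter fun e => G.src e = v) (by simp) ⟨e, by simpa using hsrc e he⟩]
    refine (Finset.sum_map t (Function.Embedding.subtype _)
      (fun e => F.S e * star (F.S e))).symm.trans
      (Finset.sum_subset (fun e he => ?_) fun e he het => ?_)
    · obtain ⟨e', he', rfl⟩ := Finset.mem_map.mp he
      simpa using hsrc e' he'
    · have hv : G.src e = v := (Finset.mem_filter.mp he).2
      have hr : G.rng e = v₀ := by
        by_contra hr
        exact het (Finset.mem_map.mpr ⟨⟨e, hv ▸ v.2, hr⟩, (ht _).mpr (Subtype.ext hv), rfl⟩)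
      rw [S_eq_zero (F := F) (hr ▸ h₀), zero_mul]

/-- A Cuntz–Krieger family of the trimmed graph whose projection at the base `v₀` of the loop
vanishes is a Cuntz–Krieger family of the whole graph, with `S_{e₀} = 0`. -/
def extendLoop {v₀ : V} {e₀ : E} (h : G.IsTrimmable v₀ e₀) (F : CKFamily (G.removeEdge e₀) B)
    (h₀ : F.P v₀ = 0) : CKFamily G B := by
  classical exact
  { P := F.P
    S := fun e => if he : e = e₀ then 0 else F.S ⟨e, he⟩
    isStarProjection := F.isStarProjection
    orthogonal := F.orthogonal
    partialIsometry := fun e => by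
      split_ifs with he
      · simp
      · exact F.partialIsometry ⟨e, he⟩
    ck1 := fun e => by
      split_ifs with he
      · rw [he, h.rng_loop, h₀, mul_zero]
      · exact F.ck1 ⟨e, he⟩
    ck2 := fun v t ht hne => by
      by_cases hv : v = v₀
      · rw [hv, h₀]
        refine Finset.sum_eq_zero fun e he => ?_
        rw [dif_pos ((h.src_eq_iff e).mp (((ht e).mp he).trans hv)), zero_mul]
      · have hmem : ∀ e ∈ t, e ≠ e₀ := fun e he hc =>
          hv (((ht e).mp he).symm.trans ((h.src_eq_iff e).mpr hc))
        obtain ⟨e, he⟩ := hne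
        refine Eq.trans ?_ (F.ck2 v
          (t.subtype fun e => e ≠ e₀) (fun e => by rw [Finset.mem_subtype, ht]; rfl)
          ⟨⟨e, hmem e he⟩, Finset.mem_subtype.mpr he⟩)
        rw [← Finset.sum_filter_of_ne (p := fun e => e ≠ e₀) (fun e he _ => hmem e he),
          ← Finset.sum_subtype_eq_sum_filter]
        exact Finset.sum_congr rfl fun e _ => by rw [dif_neg e.2] }

/-- A Cuntz–Krieger family of a graph restricts to the graph without the loop: the base of the loop
becomes a sink, so that no relation is left there. -/
def removeLoop {v₀ : V} {e₀ : E} (h : G.IsTrimmable v₀ e₀) (F : CKFamily G B) :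
    CKFamily (G.removeEdge e₀) B where
  P := F.P
  S e := F.S e
  isStarProjection := F.isStarProjection
  orthogonal := F.orthogonal
  partialIsometry e := F.partialIsometry e
  ck1 e := F.ck1 e
  ck2 v t ht hne := by
    obtain ⟨e, he⟩ := hne
    have hv : v ≠ v₀ := fun hv => e.2 ((h.src_eq_iff e).mp (((ht e).mp he).trans hv))
    refine (Finset.sum_map t (Function.Embedding.subtype _)
      (fun e => F.S e * star (F.S e))).symm.trans
      (F.ck2 v _ (fun e' => ⟨fun he' => ?_, fun he' => ?_⟩) ⟨e, by simpa using ⟨e.2, he⟩⟩)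
    · obtain ⟨e'', he'', rfl⟩ := Finset.mem_map.mp he'
      exact (ht e'').mp he''
    · have hne : e' ≠ e₀ := fun hc => hv (he' ▸ (h.src_eq_iff e').mpr hc)
      exact Finset.mem_map.mpr ⟨⟨e', hne⟩, (ht ⟨e', hne⟩).mpr he', rfl⟩

end CKFamily

namespace IsTrimmable

variable {v₀ : V} {e₀ : E}

theorem rng_eq_of_not (h : G.IsTrimmable v₀ e₀) {e : E} (he : ¬(G.src e ≠ v₀ ∧ G.rng e ≠ v₀)) :
    G.rng e = v₀ := by
  by_contra hr
  have hs : G.src e = v₀ := by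
    by_contra hs
    exact he ⟨hs, hr⟩
  exact hr (((h.src_eq_iff e).mp hs) ▸ h.rng_loop)

theorem quotientFamily_P (h : G.IsTrimmable v₀ e₀) (v : {v // v ≠ v₀}) :
    h.quotientFamily.P v = (CStar.family (G.removeVertex v₀)).P v := dif_pos v.2

theorem quotientFamily_P_self (h : G.IsTrimmable v₀ e₀) : h.quotientFamily.P v₀ = 0 :=
  dif_neg (by simp)

theorem quotientFamily_S (h : G.IsTrimmable v₀ e₀) (e : {e // G.src e ≠ v₀ ∧ G.rng e ≠ v₀}) :
    h.quotientFamily.S e = (CStar.family (G.removeVertex v₀)).S e := dif_pos e.2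

theorem quotientFamily_S_of_rng (h : G.IsTrimmable v₀ e₀) {e : E} (he : G.rng e = v₀) :
    h.quotientFamily.S e = 0 :=
  dif_neg fun h' => h'.2 he

theorem quotientMap_P_self (h : G.IsTrimmable v₀ e₀) :
    h.quotientMap ((CStar.family G).P v₀) = 0 :=
  (CStar.lift_P _ _).trans h.quotientFamily_P_self

theorem quotientMap'_P_self (h : G.IsTrimmable v₀ e₀) :
    h.quotientMap' ((CStar.family (G.removeEdge e₀)).P v₀) = 0 :=
  (CStar.lift_P _ _).trans h.quotientFamily_P_self

theorem isQuotientByIdeal_quotientMap [Finite E] (h : G.IsTrimmable v₀ e₀) :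
    IsQuotientByIdeal h.quotientMap ((CStar.family G).P v₀) := by
  let hp := (CStar.family G).isStarProjection v₀
  let I := ClosedStarIdeal.ofProjection hp
  let F : CKFamily G I.Quot := (CStar.family G).map (ClosedStarIdeal.Quot.mkHom I)
  have hF : F.P v₀ = 0 :=
    (ClosedStarIdeal.Quot.mk_eq_zero I).mpr (ClosedStarIdeal.self_mem_ofProjection hp)
  have hψ : (CStar.lift (F.removeVertex hF)).comp h.quotientMap =
      ClosedStarIdeal.Quot.mkHom I := by
    refine CStar.hom_ext (fun v => ?_) fun e => ?_
    · rw [NonUnitalStarAlgHom.comp_apply, quotientMap, CStar.lift_P]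
      by_cases hv : v = v₀
      · rw [hv, h.quotientFamily_P_self, map_zero]
        exact hF.symm
      · rw [h.quotientFamily_P ⟨v, hv⟩, CStar.lift_P]
        rfl
    · rw [NonUnitalStarAlgHom.comp_apply, quotientMap, CStar.lift_S]
      by_cases he : G.src e ≠ v₀ ∧ G.rng e ≠ v₀
      · rw [h.quotientFamily_S ⟨e, he⟩, CStar.lift_S]
        rfl
      · rw [h.quotientFamily_S_of_rng (h.rng_eq_of_not he), map_zero]
        exact (CKFamily.S_eq_zero (F := F) (h.rng_eq_of_not he ▸ hF)).symm
  refine ClosedStarIdeal.isQuotientByIdeal_of_inverse hp h.quotientMap_P_self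
    (CStar.lift (F.removeVertex hF)) (DFunLike.congr_fun hψ) ?_
  refine DFunLike.congr_fun (f := (ClosedStarIdeal.Quot.liftHom I h.quotientMap fun _ =>
    ClosedStarIdeal.map_eq_zero_of_mem_ofProjection hp h.quotientMap_P_self).comp
      (CStar.lift (F.removeVertex hF))) (g := NonUnitalStarAlgHom.id ℂ _)
    (CStar.hom_ext (fun v => ?_) fun e => ?_)
  · rw [NonUnitalStarAlgHom.comp_apply, CStar.lift_P]
    refine (ClosedStarIdeal.Quot.liftHom_mkHom I _ _ _).trans ?_
    exact (CStar.lift_P _ _).trans (h.quotientFamily_P v)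
  · rw [NonUnitalStarAlgHom.comp_apply, CStar.lift_S]
    refine (ClosedStarIdeal.Quot.liftHom_mkHom I _ _ _).trans ?_
    exact (CStar.lift_S _ _).trans (h.quotientFamily_S e)

theorem isQuotientByIdeal_quotientMap' [Finite E] (h : G.IsTrimmable v₀ e₀) :
    IsQuotientByIdeal h.quotientMap' ((CStar.family (G.removeEdge e₀)).P v₀) := by
  let hp := (CStar.family (G.removeEdge e₀)).isStarProjection v₀
  let I := ClosedStarIdeal.ofProjection hp
  let F' : CKFamily (G.removeEdge e₀) I.Quot :=
    (CStar.family (G.removeEdge e₀)).map (ClosedStarIdeal.Quot.mkHom I)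
  have hF : F'.P v₀ = 0 :=
    (ClosedStarIdeal.Quot.mk_eq_zero I).mpr (ClosedStarIdeal.self_mem_ofProjection hp)
  let F : CKFamily G I.Quot := CKFamily.extendLoop h F' hF
  have hFS : ∀ e : {e // e ≠ e₀}, F.S e = F'.S e := fun e => dif_neg e.2
  have hψ : (CStar.lift (F.removeVertex hF)).comp h.quotientMap' =
      ClosedStarIdeal.Quot.mkHom I := by
    refine CStar.hom_ext (fun v => ?_) fun e => ?_
    · rw [NonUnitalStarAlgHom.comp_apply, quotientMap', CStar.lift_P]
      change CStar.lift _ (h.quotientFamily.P v) = _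
      by_cases hv : v = v₀
      · rw [hv, h.quotientFamily_P_self, map_zero]
        exact hF.symm
      · rw [h.quotientFamily_P ⟨v, hv⟩, CStar.lift_P]
        rfl
    · rw [NonUnitalStarAlgHom.comp_apply, quotientMap', CStar.lift_S]
      change CStar.lift _ (h.quotientFamily.S e) = F'.S e
      rw [← hFS]
      by_cases he : G.src e ≠ v₀ ∧ G.rng e ≠ v₀
      · rw [h.quotientFamily_S ⟨e, he⟩, CStar.lift_S]
        rfl
      · rw [h.quotientFamily_S_of_rng (h.rng_eq_of_not he), map_zero]
        exact (CKFamily.S_eq_zero (F := F) (h.rng_eq_of_not he ▸ hF)).symm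
  refine ClosedStarIdeal.isQuotientByIdeal_of_inverse hp h.quotientMap'_P_self
    (CStar.lift (F.removeVertex hF)) (DFunLike.congr_fun hψ) ?_
  refine DFunLike.congr_fun (f := (ClosedStarIdeal.Quot.liftHom I h.quotientMap' fun _ =>
    ClosedStarIdeal.map_eq_zero_of_mem_ofProjection hp h.quotientMap'_P_self).comp
      (CStar.lift (F.removeVertex hF))) (g := NonUnitalStarAlgHom.id ℂ _)
    (CStar.hom_ext (fun v => ?_) fun e => ?_)
  · rw [NonUnitalStarAlgHom.comp_apply, CStar.lift_P]
    refine (ClosedStarIdeal.Quot.liftHom_mkHom I _ _ _).trans ?_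
    exact (CStar.lift_P _ _).trans (h.quotientFamily_P v)
  · have he : (e : E) ≠ e₀ := fun hc => e.2.2 (hc ▸ h.rng_loop)
    rw [NonUnitalStarAlgHom.comp_apply, CStar.lift_S]
    change ClosedStarIdeal.Quot.liftHom I _ _ (F.S (⟨e, he⟩ : {e // e ≠ e₀})) = _
    rw [hFS]
    refine (ClosedStarIdeal.Quot.liftHom_mkHom I _ _ _).trans ?_
    exact (CStar.lift_S _ _).trans (h.quotientFamily_S e)

theorem isEquivariant_quotientMap (h : G.IsTrimmable v₀ e₀) :
    IsEquivariant G.gaugeAction (G.removeVertex v₀).gaugeAction h.quotientMap := fun z => by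
  refine DFunLike.congr_fun (f := h.quotientMap.comp (G.gaugeAction.act z))
    (g := ((G.removeVertex v₀).gaugeAction.act z).comp h.quotientMap)
    (CStar.hom_ext (fun v => ?_) fun e => ?_)
  · simp only [NonUnitalStarAlgHom.comp_apply, gaugeAction, quotientMap, CStar.lift_P,
      CKFamily.rotate]
    by_cases hv : v = v₀
    · rw [hv, h.quotientFamily_P_self, map_zero]
    · rw [h.quotientFamily_P ⟨v, hv⟩, CStar.lift_P]
  · simp only [NonUnitalStarAlgHom.comp_apply, gaugeAction, quotientMap, CStar.lift_S,
      CKFamily.rotate, map_smul]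
    by_cases he : G.src e ≠ v₀ ∧ G.rng e ≠ v₀
    · rw [h.quotientFamily_S ⟨e, he⟩, CStar.lift_S]
    · rw [h.quotientFamily_S_of_rng (h.rng_eq_of_not he), map_zero, smul_zero]

theorem tensorFamily_S_loop (h : G.IsTrimmable v₀ e₀) :
    h.tensorFamily.S e₀ = elemTensor ((CStar.family (G.removeEdge e₀)).P v₀) circleU := dif_pos rfl

theorem tensorFamily_S (h : G.IsTrimmable v₀ e₀) (e : {e // e ≠ e₀}) :
    h.tensorFamily.S e = elemTensor ((CStar.family (G.removeEdge e₀)).S e) circleU := dif_neg e.2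

theorem isEquivariant_tensorMap (h : G.IsTrimmable v₀ e₀) :
    IsEquivariant G.gaugeAction (rotationAction (G.removeEdge e₀).CStar) h.tensorMap := fun z => by
  refine DFunLike.congr_fun (f := h.tensorMap.comp (G.gaugeAction.act z))
    (g := ((rotationAction _).act z).comp h.tensorMap)
    (CStar.hom_ext (fun v => ?_) fun e => ?_)
  · simp only [NonUnitalStarAlgHom.comp_apply, gaugeAction, tensorMap, CStar.lift_P,
      CKFamily.rotate]
    rfl
  · simp only [NonUnitalStarAlgHom.comp_apply, gaugeAction, tensorMap, CStar.lift_S,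
      CKFamily.rotate, map_smul]
    by_cases he : e = e₀
    · rw [he, tensorFamily_S_loop, rotationAction_elemTensor_circleU]
    · rw [h.tensorFamily_S ⟨e, he⟩, rotationAction_elemTensor_circleU]

theorem quotientMap_tensorMap_comm (h : G.IsTrimmable v₀ e₀) (a : G.CStar) :
    (G.removeVertex v₀).gaugeCoaction (h.quotientMap a) =
      tensorId h.quotientMap' (h.tensorMap a) := by
  refine DFunLike.congr_fun (f := ((G.removeVertex v₀).gaugeCoaction).comp h.quotientMap)
    (g := (tensorId h.quotientMap').comp h.tensorMap) (CStar.hom_ext (fun v => ?_) fun e => ?_) a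
  · have h1 : h.quotientMap' ((CStar.family (G.removeEdge e₀)).P v) = h.quotientFamily.P v :=
      CStar.lift_P _ _
    simp only [NonUnitalStarAlgHom.comp_apply, quotientMap, tensorMap, CStar.lift_P]
    change _ = tensorId _ (elemTensor ((CStar.family (G.removeEdge e₀)).P v) 1)
    rw [CircleTensor.tensorId_elemTensor, h1]
    by_cases hv : v = v₀
    · rw [hv, h.quotientFamily_P_self, map_zero, CircleTensor.zero_elemTensor]
    · rw [h.quotientFamily_P ⟨v, hv⟩]
      exact CStar.lift_P _ _
  · simp only [NonUnitalStarAlgHom.comp_apply, quotientMap, tensorMap, CStar.lift_S]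
    by_cases hee : e = e₀
    · rw [hee, h.tensorFamily_S_loop, CircleTensor.tensorId_elemTensor, h.quotientMap'_P_self,
        CircleTensor.zero_elemTensor, h.quotientFamily_S_of_rng h.rng_loop, map_zero]
    · have h1 : h.quotientMap' ((CStar.family (G.removeEdge e₀)).S ⟨e, hee⟩) =
        h.quotientFamily.S e := CStar.lift_S _ _
      rw [h.tensorFamily_S ⟨e, hee⟩, CircleTensor.tensorId_elemTensor, h1]
      by_cases he : G.src e ≠ v₀ ∧ G.rng e ≠ v₀
      · rw [h.quotientFamily_S ⟨e, he⟩]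
        exact CStar.lift_S _ _
      · rw [h.quotientFamily_S_of_rng (h.rng_eq_of_not he), map_zero,
          CircleTensor.zero_elemTensor]

end IsTrimmable

theorem isEquivariant_gaugeCoaction (G : DirectedGraph V E) :
    IsEquivariant G.gaugeAction (rotationAction G.CStar) G.gaugeCoaction := fun z => by
  refine DFunLike.congr_fun (f := G.gaugeCoaction.comp (G.gaugeAction.act z))
    (g := ((rotationAction _).act z).comp G.gaugeCoaction)
    (CStar.hom_ext (fun v => ?_) fun e => ?_)
  · simp only [NonUnitalStarAlgHom.comp_apply, gaugeAction, gaugeCoaction, CStar.lift_P,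
      CKFamily.rotate]
    rfl
  · simp only [NonUnitalStarAlgHom.comp_apply, gaugeAction, gaugeCoaction, CStar.lift_S,
      CKFamily.rotate, map_smul]
    exact (rotationAction_elemTensor_circleU _ _).symm

end DirectedGraph

theorem isEquivariant_tensorId {A B : Type*} [NonUnitalCStarAlgebra A] [NonUnitalCStarAlgebra B]
    (φ : A →⋆ₙₐ[ℂ] B) : IsEquivariant (rotationAction A) (rotationAction B) (tensorId φ) :=
  fun _ _ => rfl

/-! ### Subspaces that are invariant under multiplication by generators -/

/-- The `*`-subalgebra of all `a` such that left multiplication by `a` and by its adjoint leaves a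
given subspace invariant. -/
def leftMultipliers {A : Type*} [NonUnitalCStarAlgebra A] (X : Submodule ℂ A) :
    NonUnitalStarSubalgebra ℂ A where
  carrier := {a | ∀ x ∈ X, a * x ∈ X ∧ star a * x ∈ X}
  zero_mem' := fun x _ => by simp
  add_mem' := fun ha hb x hx => by
    rw [star_add, add_mul, add_mul]
    exact ⟨X.add_mem (ha x hx).1 (hb x hx).1, X.add_mem (ha x hx).2 (hb x hx).2⟩
  mul_mem' := fun ha hb x hx => by
    rw [star_mul, mul_assoc, mul_assoc]
    exact ⟨(ha _ (hb x hx).1).1, (hb _ (ha x hx).2).2⟩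
  smul_mem' := fun c a ha x hx => by
    rw [star_smul, smul_mul_assoc, smul_mul_assoc]
    exact ⟨X.smul_mem _ (ha x hx).1, X.smul_mem _ (ha x hx).2⟩
  star_mem' := fun ha x hx => by
    rw [star_star]
    exact (ha x hx).symm

theorem isClosed_leftMultipliers {A : Type*} [NonUnitalCStarAlgebra A] {X : Submodule ℂ A}
    (hX : IsClosed (X : Set A)) : IsClosed (leftMultipliers X : Set A) := by
  have : (leftMultipliers X : Set A) = ⋂ x ∈ X, {a | a * x ∈ X} ∩ {a | star a * x ∈ X} := by
    ext a
    simp only [Set.mem_iInter]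
    rfl
  rw [this]
  exact isClosed_biInter fun x _ =>
    (hX.preimage (by fun_prop : Continuous fun a => a * x)).inter
      (hX.preimage (by fun_prop : Continuous fun a => star a * x))

/-- A closed subspace of `C*(G)` is a left ideal if it is invariant under left multiplication by the
generators and their adjoints. -/
theorem DirectedGraph.CStar.mul_mem_of_isClosed {V E : Type*} {G : DirectedGraph V E}
    {X : Submodule ℂ G.CStar} (hX : IsClosed (X : Set G.CStar))
    (hP : ∀ v, ∀ x ∈ X, (family G).P v * x ∈ X) (hS : ∀ e, ∀ x ∈ X, (family G).S e * x ∈ X)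
    (hS' : ∀ e, ∀ x ∈ X, star ((family G).S e) * x ∈ X) (a : G.CStar) {x : G.CStar}
    (hx : x ∈ X) : a * x ∈ X := by
  refine (eq_top_of_isClosed G (leftMultipliers X) (isClosed_leftMultipliers hX)
    (fun v x hx => ⟨hP v x hx, ?_⟩) (fun e x hx => ⟨hS e x hx, hS' e x hx⟩) a x hx).1
  rw [((family G).isStarProjection v).isSelfAdjoint.star_eq]
  exact hP v x hx

/-- A closed subspace of `C(S¹)` that contains `1` and is invariant under multiplication by the
generator `u` and its adjoint is everything: its multipliers form a closed `*`-subalgebra that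
separates points. -/
theorem mem_of_circleU_mul_mem {X : Submodule ℂ C(Circle, ℂ)}
    (hX : IsClosed (X : Set C(Circle, ℂ))) (h1 : 1 ∈ X) (hu : ∀ g ∈ X, circleU * g ∈ X)
    (hu' : ∀ g ∈ X, star circleU * g ∈ X) (g : C(Circle, ℂ)) : g ∈ X := by
  let T : StarSubalgebra ℂ C(Circle, ℂ) :=
    { leftMultipliers X with
      algebraMap_mem' := fun c x hx => by
        rw [← algebraMap_star_comm, ← Algebra.smul_def, ← Algebra.smul_def]
        exact ⟨X.smul_mem _ hx, X.smul_mem _ hx⟩ }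
  have htop : T.topologicalClosure = ⊤ :=
    ContinuousMap.starSubalgebra_topologicalClosure_eq_top_of_separatesPoints T fun z w hzw =>
      ⟨circleU, ⟨circleU, fun x hx => ⟨hu x hx, hu' x hx⟩, rfl⟩, fun h => hzw (Circle.ext h)⟩
  have hg : g ∈ T.topologicalClosure := htop ▸ StarSubalgebra.mem_top
  have hg' : g ∈ T := T.topologicalClosure_minimal le_rfl (isClosed_leftMultipliers hX) hg
  simpa using (hg' 1 h1).1

/-! ### Functional calculus for a unitary in a corner -/

/-- If `s` is a unitary in the corner `p A p`, then `u ↦ s`, `1 ↦ p` extends to a contraction from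
`C(S¹)` to `A`, which is obtained by compressing the functional calculus of the unitary
`1 - p + s` of the unitization. -/
theorem exists_circle_calculus {A : Type*} [NonUnitalCStarAlgebra A] {s p : A}
    (hp : IsStarProjection p) (h1 : star s * s = p) (h2 : s * star s = p)
    (h3 : s * star s * s = s) :
    ∃ φ : C(Circle, ℂ) →ₗ[ℂ] A, φ 1 = p ∧ (∀ g, φ (circleU * g) = s * φ g) ∧
      (∀ g, φ (star circleU * g) = star s * φ g) ∧ ∀ g, ‖φ g‖ ≤ ‖g‖ := by
  have hps : p * s = s := by rw [← h2, h3]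
  have hsp : s * p = s := by rw [← h1, ← mul_assoc, h3]
  have hsp' : star s * p = star s := by
    rw [← hp.isSelfAdjoint.star_eq, ← star_mul, hps]
  have hps' : p * star s = star s := by
    rw [← hp.isSelfAdjoint.star_eq, ← star_mul, hsp]
  let P : Unitization ℂ A := p
  let S : Unitization ℂ A := s
  have hPP : P * P = P := by simp only [P, ← Unitization.inr_mul, hp.isIdempotentElem.eq]
  have hP' : star P = P := by simp only [P, ← Unitization.inr_star, hp.isSelfAdjoint.star_eq]
  have hPS : P * S = S := by simp only [P, S, ← Unitization.inr_mul, hps]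
  have hSP : S * P = S := by simp only [P, S, ← Unitization.inr_mul, hsp]
  have hPS' : P * star S = star S := by
    simp only [P, S, ← Unitization.inr_star, ← Unitization.inr_mul, hps']
  have hSP' : star S * P = star S := by
    simp only [P, S, ← Unitization.inr_star, ← Unitization.inr_mul, hsp']
  have hSS : star S * S = P := by
    simp only [P, S, ← Unitization.inr_star, ← Unitization.inr_mul, h1]
  have hSS' : S * star S = P := by
    simp only [P, S, ← Unitization.inr_star, ← Unitization.inr_mul, h2]
  let U : Unitization ℂ A := 1 - P + S
  have hU' : star U = 1 - P + star S := by simp [U, hP']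
  have hU : U ∈ unitary (Unitization ℂ A) := by
    rw [Unitary.mem_iff, hU']
    constructor
    · simp only [U, mul_add, add_mul, sub_mul, mul_sub, one_mul, mul_one, hPP, hPS, hSP', hSS]
      abel
    · simp only [U, mul_add, add_mul, sub_mul, mul_sub, one_mul, mul_one, hPP, hSP, hPS', hSS']
      abel
  have hN : IsStarNormal U := ⟨by
    rw [commute_iff_eq, (Unitary.mem_iff.mp hU).1, (Unitary.mem_iff.mp hU).2]⟩
  let ι : C(spectrum ℂ U, Circle) :=
    ⟨fun z => ⟨z, Unitary.spectrum_subset_circle (⟨U, hU⟩ : unitary (Unitization ℂ A)) z.2⟩,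
      by fun_prop⟩
  let Ψ : C(Circle, ℂ) →⋆ₐ[ℂ] Unitization ℂ A :=
    (cfcHom (R := ℂ) hN).comp (ContinuousMap.compStarAlgHom' ℂ ℂ ι)
  have hΨu : Ψ circleU = U := cfcHom_id (R := ℂ) hN
  have hinr : ∀ g, (((P * (Ψ g * P)).snd : A) : Unitization ℂ A) = P * (Ψ g * P) := fun g => by
    ext
    · simp [P]
    · simp
  have hPU : P * U = S * P := by
    simp only [U, mul_add, mul_sub, mul_one, hPP, hPS, hSP, sub_self, zero_add]
  have hPU' : P * star U = star S * P := by
    rw [hU']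
    simp only [mul_add, mul_sub, mul_one, hPP, hPS', hSP', sub_self, zero_add]
  refine ⟨{ toFun := fun g => (P * (Ψ g * P)).snd
            map_add' := fun g g' => by rw [map_add, add_mul, mul_add, Unitization.snd_add]
            map_smul' := fun c g => by
              rw [map_smul, smul_mul_assoc, mul_smul_comm, Unitization.snd_smul]; rfl },
    ?_, fun g => ?_, fun g => ?_, fun g => ?_⟩
  · simp [P, hp.isIdempotentElem.eq]
  · apply Unitization.inr_injective (R := ℂ)
    change (((P * (Ψ (circleU * g) * P)).snd : A) : Unitization ℂ A) =
      ((s * (P * (Ψ g * P)).snd : A) : Unitization ℂ A)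
    rw [Unitization.inr_mul, hinr, hinr, map_mul, hΨu, mul_assoc, ← mul_assoc, hPU, mul_assoc]
  · apply Unitization.inr_injective (R := ℂ)
    change (((P * (Ψ (star circleU * g) * P)).snd : A) : Unitization ℂ A) =
      ((star s * (P * (Ψ g * P)).snd : A) : Unitization ℂ A)
    rw [Unitization.inr_mul, hinr, hinr, map_mul, map_star, hΨu, mul_assoc, ← mul_assoc, hPU',
      mul_assoc, Unitization.inr_star]
  · apply (Unitization.norm_inr (𝕜 := ℂ) (A := A) _).symm.trans_le
    change ‖((P * (Ψ g * P)).snd : Unitization ℂ A)‖ ≤ _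
    rw [hinr]
    have hPn : ‖P‖ ≤ 1 := (Unitization.norm_inr p).trans_le hp.norm_le
    calc ‖P * (Ψ g * P)‖ ≤ ‖P‖ * (‖Ψ g‖ * ‖P‖) :=
          (norm_mul_le _ _).trans (by gcongr; exact norm_mul_le _ _)
      _ ≤ 1 * (‖g‖ * 1) := by
          gcongr
          exact NonUnitalStarAlgHom.norm_apply_le Ψ g
      _ = ‖g‖ := by rw [one_mul, mul_one]

/-! ### Orthogonality relations in a Cuntz–Krieger family -/

theorem eq_zero_of_sum_star_mul_self_eq_zero {B ι : Type*} [NonUnitalCStarAlgebra B] {t : Finset ι}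
    {x : ι → B} (h : ∑ i ∈ t, star (x i) * x i = 0) {i : ι} (hi : i ∈ t) : x i = 0 := by
  let _ : PartialOrder B := CStarAlgebra.spectralOrder B
  have : StarOrderedRing B := CStarAlgebra.spectralOrderedRing B
  exact CStarRing.star_mul_self_eq_zero_iff _ |>.mp
    ((Finset.sum_eq_zero_iff_of_nonneg fun i _ => star_mul_self_nonneg (x i)).mp h i hi)

namespace DirectedGraph.CKFamily

variable {V E : Type*} {G : DirectedGraph V E} {B : Type*} [NonUnitalCStarAlgebra B]
  (F : CKFamily G B)

theorem sum_S_mul_star [Fintype E] [DecidableEq V] (e : E) :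
    ∑ f with G.src f = G.src e, F.S f * star (F.S f) = F.P (G.src e) :=
  F.ck2 _ _ (by simp) ⟨e, by simp⟩

theorem P_mul_S [Finite E] (e : E) : F.P (G.src e) * F.S e = F.S e := by
  classical
  cases nonempty_fintype E
  have hP := (F.isStarProjection (G.src e)).isIdempotentElem.eq
  have hP' := (F.isStarProjection (G.src e)).isSelfAdjoint.star_eq
  have hsum := F.sum_S_mul_star e
  set p := F.P (G.src e)
  have h : ∑ f with G.src f = G.src e,
      star (star (F.S f) - star (F.S f) * p) * (star (F.S f) - star (F.S f) * p) = 0 := by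
    have : ∀ f, star (star (F.S f) - star (F.S f) * p) * (star (F.S f) - star (F.S f) * p) =
        (F.S f * star (F.S f)) - p * (F.S f * star (F.S f)) -
          ((F.S f * star (F.S f)) * p - p * (F.S f * star (F.S f)) * p) := fun f => by
      rw [star_sub, star_mul, star_star, hP']
      noncomm_ring
    simp only [this, Finset.sum_sub_distrib, ← Finset.mul_sum, ← Finset.sum_mul, hsum, hP, sub_self]
  have h1 := congrArg star (sub_eq_zero.mp (eq_zero_of_sum_star_mul_self_eq_zero h
    (i := e) (by simp)))
  rw [star_mul, star_star, hP'] at h1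
  exact h1.symm

theorem P_mul_S_of_ne [Finite E] {v : V} {e : E} (h : v ≠ G.src e) : F.P v * F.S e = 0 := by
  rw [← F.P_mul_S, ← mul_assoc, F.orthogonal _ _ h, zero_mul]

theorem star_S_mul_P_of_ne [Finite E] {v : V} {e : E} (h : v ≠ G.src e) :
    star (F.S e) * F.P v = 0 := by
  rw [← (F.isStarProjection v).isSelfAdjoint.star_eq, ← star_mul, F.P_mul_S_of_ne h, star_zero]

/-- Distinct edges have orthogonal range projections: for a common source `v` this follows by
compressing `∑ S_f S_f* = P_v` with `S_e`. -/
theorem star_S_mul_S [Finite E] {e f : E} (hef : e ≠ f) : star (F.S f) * F.S e = 0 := by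
  classical
  cases nonempty_fintype E
  by_cases hs : G.src f = G.src e
  · have h1 : ∑ g with G.src g = G.src e,
        star (star (F.S g) * F.S e) * (star (F.S g) * F.S e) = star (F.S e) * F.S e := by
      have : ∀ g, star (star (F.S g) * F.S e) * (star (F.S g) * F.S e) =
          star (F.S e) * ((F.S g * star (F.S g)) * F.S e) := fun g => by
        rw [star_mul, star_star]
        noncomm_ring
      simp only [this, ← Finset.mul_sum, ← Finset.sum_mul]
      rw [F.sum_S_mul_star, F.P_mul_S]
    rw [← Finset.add_sum_erase (Finset.univ.filter fun g => G.src g = G.src e) _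
      (a := e) (by simp)] at h1
    have h2 : star (star (F.S e) * F.S e) * (star (F.S e) * F.S e) = star (F.S e) * F.S e := by
      rw [star_mul, star_star, mul_assoc, ← mul_assoc (F.S e), F.partialIsometry]
    rw [h2, add_eq_left] at h1
    exact eq_zero_of_sum_star_mul_self_eq_zero h1 (i := f)
      (Finset.mem_erase.mpr ⟨hef.symm, by simpa using hs⟩)
  · rw [← F.P_mul_S e, ← mul_assoc, F.star_S_mul_P_of_ne (Ne.symm hs), zero_mul]

end DirectedGraph.CKFamily

/-! ### The corner at the base of the loop -/

namespace DirectedGraph.IsTrimmable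

variable {V E : Type*} {G : DirectedGraph V E} {v₀ : V} {e₀ : E}

/-- The elements `S_{e₁} ⋯ S_{eₙ} φ(g)` with edges `e₁, …, eₙ` different from `e₀`. -/
inductive IsLoopWord (G : DirectedGraph V E) (e₀ : E) (φ : C(Circle, ℂ) →ₗ[ℂ] G.CStar) :
    G.CStar → Prop
  | base (g : C(Circle, ℂ)) : IsLoopWord G e₀ φ (φ g)
  | step (e : E) (he : e ≠ e₀) (y : G.CStar) (hy : IsLoopWord G e₀ φ y) :
      IsLoopWord G e₀ φ ((CStar.family G).S e * y)

/-- The corner of `C*(G)` at the base of the loop is generated by the loop. Here `φ` is the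
functional calculus of `S_{e₀}` in the corner. The closed span of the words
`S_{e₁} ⋯ S_{eₙ} φ(g)` is a left ideal that contains `P_{v₀}`, and left multiplication by `P_{v₀}`
annihilates all words with `n > 0`. -/
theorem corner_subset_closure [Finite E] (h : G.IsTrimmable v₀ e₀)
    {φ : C(Circle, ℂ) →ₗ[ℂ] G.CStar} (h1 : φ 1 = (CStar.family G).P v₀)
    (hu : ∀ g, φ (circleU * g) = (CStar.family G).S e₀ * φ g)
    (hu' : ∀ g, φ (star circleU * g) = star ((CStar.family G).S e₀) * φ g) (x : G.CStar) :
    (CStar.family G).P v₀ * (x * (CStar.family G).P v₀) ∈ closure (Set.range φ) := by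
  set F := CStar.family G with hF
  have hsrc : G.src e₀ = v₀ := (h.src_eq_iff e₀).mpr rfl
  have hne : ∀ {e}, e ≠ e₀ → v₀ ≠ G.src e := fun he hc => he ((h.src_eq_iff _).mp hc.symm)
  have hPφ : ∀ g, F.P v₀ * φ g = φ g := fun g => by
    have : g = circleU * (star circleU * g) := by
      rw [← mul_assoc, CircleTensor.circleU_mul_star, one_mul]
    rw [this, hu, ← mul_assoc, ← hsrc, F.P_mul_S]
  have hPw : ∀ v y, IsLoopWord G e₀ φ y → F.P v * y = 0 ∨ F.P v * y = y := by
    rintro v _ (g | ⟨e, he, y, hy⟩)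
    · by_cases hv : v = v₀
      · right; rw [hv, hPφ]
      · left; rw [← hPφ, ← mul_assoc, F.orthogonal _ _ hv, zero_mul]
    · by_cases hv : v = G.src e
      · right; rw [← mul_assoc, hv, F.P_mul_S]
      · left; rw [← mul_assoc, F.P_mul_S_of_ne hv, zero_mul]
  let X : Submodule ℂ G.CStar := (Submodule.span ℂ {y | IsLoopWord G e₀ φ y}).topologicalClosure
  have hX : IsClosed (X : Set G.CStar) := Submodule.isClosed_topologicalClosure _
  have hwX : ∀ {y}, IsLoopWord G e₀ φ y → y ∈ X := fun hy =>
    Submodule.le_topologicalClosure _ (Submodule.subset_span hy)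
  have hPX : ∀ v y, IsLoopWord G e₀ φ y → F.P v * y ∈ X := fun v y hy => by
    rcases hPw v y hy with h0 | h0 <;> rw [h0]
    · exact X.zero_mem
    · exact hwX hy
  -- membership in a closed subspace after left multiplication can be checked on words
  have hext : ∀ (Y : Submodule ℂ G.CStar), IsClosed (Y : Set G.CStar) → ∀ a : G.CStar,
      (∀ y, IsLoopWord G e₀ φ y → a * y ∈ Y) → ∀ y ∈ X, a * y ∈ Y := fun Y hY a ha y hy => by
    have hle : Submodule.span ℂ {y | IsLoopWord G e₀ φ y} ≤ Y.comap (LinearMap.mulLeft ℂ a) :=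
      Submodule.span_le.mpr ha
    exact Submodule.topologicalClosure_minimal _ hle (hY.preimage (continuous_const_mul a)) hy
  have hmem : x * F.P v₀ ∈ X := by
    refine CStar.mul_mem_of_isClosed hX (fun v => hext X hX _ (hPX v))
      (fun e => hext X hX _ fun y hy => ?_) (fun e => hext X hX _ fun y hy => ?_) x
      (h1 ▸ hwX (.base 1))
    · by_cases he : e = e₀
      · subst he
        rcases hy with g | ⟨f, hf, y, hy⟩
        · rw [← hF, ← hu]
          exact hwX (.base _)
        · rw [← hF, ← F.S_mul_P, h.rng_loop, mul_assoc, ← mul_assoc (F.P v₀),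
            F.P_mul_S_of_ne (hne hf), zero_mul, mul_zero]
          exact X.zero_mem
      · exact hwX (.step e he y hy)
    · rcases hy with g | ⟨f, hf, y, hy⟩
      · by_cases he : e = e₀
        · subst he
          rw [← hF, ← hu']
          exact hwX (.base _)
        · rw [← hPφ, ← mul_assoc, ← hF, F.star_S_mul_P_of_ne (hne he), zero_mul]
          exact X.zero_mem
      · rw [← mul_assoc, ← hF]
        by_cases hef : f = e
        · rw [hef, F.ck1]
          exact hPX _ _ hy
        · rw [F.star_S_mul_S hef, zero_mul]
          exact X.zero_mem
  have hcl : closure (Set.range φ) = (φ.range.topologicalClosure : Set G.CStar) := by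
    rw [Submodule.topologicalClosure_coe, LinearMap.coe_range]
  rw [hcl]
  refine hext _ (Submodule.isClosed_topologicalClosure _) (F.P v₀) (fun y hy => ?_) _ hmem
  rcases hy with g | ⟨f, hf, y, hy⟩
  · rw [hPφ]
    exact Submodule.le_topologicalClosure _ ⟨g, rfl⟩
  · rw [← mul_assoc, ← hF, F.P_mul_S_of_ne (hne hf), zero_mul]
    exact Submodule.zero_mem _

/-- The homomorphism `f` is injective on the corner at the base `v₀` of the loop, because it maps
the functional calculus `g ↦ g(S_{e₀})` of the loop to `g ↦ P_{v₀} ⊗ g`. The projection `P_{v₀}` of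
`C*(G')` does not vanish if the one of `C*(G)` does not, as there is a homomorphism from `C*(G')` to
`C*(G)` mapping one to the other. -/
theorem eq_zero_of_tensorMap_corner_eq_zero [Finite E] (h : G.IsTrimmable v₀ e₀) {x : G.CStar}
    (hx : h.tensorMap ((CStar.family G).P v₀ * (x * (CStar.family G).P v₀)) = 0) :
    (CStar.family G).P v₀ * (x * (CStar.family G).P v₀) = 0 := by
  set F := CStar.family G with hF
  by_cases hP : F.P v₀ = 0
  · rw [hP, zero_mul]
  set p := (CStar.family (G.removeEdge e₀)).P v₀ with hp
  have hp1 : ‖p‖ = 1 := by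
    have hp0 : p ≠ 0 := fun hc => hP <|
      (CStar.lift_P (F.removeLoop h) v₀).symm.trans (by rw [← hp, hc, map_zero])
    have h2 : ‖p‖ * ‖p‖ = ‖p‖ := by
      have hpp := (CStar.family (G.removeEdge e₀)).isStarProjection v₀
      rw [← CStarRing.norm_star_mul_self, hpp.isSelfAdjoint.star_eq, hpp.isIdempotentElem.eq]
    exact mul_left_cancel₀ (norm_ne_zero_iff.mpr hp0) (h2.trans (mul_one _).symm)
  have hsrc : G.src e₀ = v₀ := (h.src_eq_iff e₀).mpr rfl
  obtain ⟨φ, h1, hu, hu', hφ⟩ := exists_circle_calculus (s := F.S e₀) (F.isStarProjection v₀)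
    (h.rng_loop ▸ F.ck1 e₀)
    ((Finset.sum_singleton _ _).symm.trans
      (F.ck2 v₀ {e₀} (by simpa [eq_comm] using fun e => (h.src_eq_iff e).symm) (by simp)))
    (F.partialIsometry e₀)
  have hfS : h.tensorMap (F.S e₀) = elemTensor p circleU :=
    (CStar.lift_S _ _).trans h.tensorFamily_S_loop
  have hpp : p * p = p :=
    ((CStar.family (G.removeEdge e₀)).isStarProjection v₀).isIdempotentElem.eq
  have hps : star p = p :=
    ((CStar.family (G.removeEdge e₀)).isStarProjection v₀).isSelfAdjoint.star_eq
  have hfφ : ∀ g, h.tensorMap (φ g) = elemTensor p g := by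
    let X : Submodule ℂ C(Circle, ℂ) :=
      { carrier := {g | h.tensorMap (φ g) = elemTensor p g}
        zero_mem' := by
          change _ = _
          rw [map_zero, map_zero, CircleTensor.elemTensor_zero]
        add_mem' := fun {a b} (ha : _ = _) (hb : _ = _) => by
          change _ = _
          rw [map_add, map_add, ha, hb, CircleTensor.elemTensor_add]
        smul_mem' := fun c a (ha : _ = _) => by
          change _ = _
          rw [map_smul, map_smul, ha, CircleTensor.elemTensor_smul] }
    have hcont : Continuous φ := AddMonoidHomClass.continuous_of_bound φ 1 (by simpa using hφ)
    have hcont' : Continuous fun g => elemTensor p g :=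
      CircleTensor.continuous_elemTensor_right p
    refine mem_of_circleU_mul_mem (X := X)
      (isClosed_eq ((CStar.continuous_hom h.tensorMap).comp hcont) hcont') ?_ ?_ ?_
    · change h.tensorMap (φ 1) = elemTensor p 1
      rw [h1]
      exact CStar.lift_P _ _
    · intro g (hg : _ = _)
      change _ = _
      rw [hu, map_mul, hg, hfS, CircleTensor.elemTensor_mul, hpp]
    · intro g (hg : _ = _)
      change _ = _
      rw [hu', map_mul, hg, map_star, hfS, CircleTensor.star_elemTensor, hps,
        CircleTensor.elemTensor_mul, hpp]
  have hnorm : ∀ y ∈ closure (Set.range φ), ‖y‖ ≤ ‖h.tensorMap y‖ := by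
    intro y hy
    refine closure_minimal (t := {y | ‖y‖ ≤ ‖h.tensorMap y‖}) ?_
      (isClosed_le continuous_norm (CStar.continuous_hom h.tensorMap).norm) hy
    rintro _ ⟨g, rfl⟩
    change ‖φ g‖ ≤ ‖h.tensorMap (φ g)‖
    rw [hfφ]
    refine (hφ g).trans ((ContinuousMap.norm_le _ (norm_nonneg _)).mpr fun z => ?_)
    have := (elemTensor p g).norm_coe_le_norm z
    rwa [CircleTensor.elemTensor_apply, norm_smul, hp1, mul_one] at this
  have := hnorm _ (h.corner_subset_closure h1 hu hu' x)
  rw [hx, norm_zero] at this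
  exact norm_le_zero_iff.mp this

end DirectedGraph.IsTrimmable

/-! ### The pullback property -/

namespace DirectedGraph

/-- The closed ideal of `C*(G)` generated by the projection at a vertex. -/
abbrev vertexIdeal {V E : Type*} (G : DirectedGraph V E) (v : V) : ClosedStarIdeal G.CStar :=
  ClosedStarIdeal.ofProjection ((CStar.family G).isStarProjection v)

namespace IsTrimmable

variable {V E : Type*} {G : DirectedGraph V E} {v₀ : V} {e₀ : E}

/-- The homomorphism `f` is injective on the ideal generated by `P_{v₀}`, as it is injective on the
corresponding corner: if `f(a) = 0`, then `a c P_{v₀} = 0` for all `c` by the `C*`-identity, so that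
`a` annihilates the ideal, to which it belongs itself. -/
theorem eq_zero_of_tensorMap_eq_zero [Finite E] (h : G.IsTrimmable v₀ e₀) {a : G.CStar}
    (ha : a ∈ (vertexIdeal G v₀).toNonUnitalStarSubalgebra) (hfa : h.tensorMap a = 0) : a = 0 := by
  have hP := (CStar.family G).isStarProjection v₀
  have h1 : ∀ c, a * c * (CStar.family G).P v₀ = 0 := fun c => by
    rw [← CStarRing.star_mul_self_eq_zero_iff, star_mul, hP.isSelfAdjoint.star_eq, mul_assoc,
      ← mul_assoc (star _)]
    apply h.eq_zero_of_tensorMap_corner_eq_zero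
    simp only [map_mul, hfa, zero_mul, mul_zero]
  have h2 : ∀ c, a * c * star a = 0 := by
    refine ClosedStarIdeal.ofProjection_subset hP (N := {x | ∀ c, a * c * x = 0}) ?_ h1 ?_ ?_ ?_ ?_
      ?_ (star_mem ha)
    · have : {x | ∀ c, a * c * x = 0} = ⋂ c, {x | a * c * x = 0} := by
        ext x
        simp
      rw [this]
      exact isClosed_iInter fun c => isClosed_eq (continuous_const_mul _) continuous_const
    · intro c
      rw [mul_zero]
    · intro x y hx hy c
      rw [mul_add, hx, hy, add_zero]
    · intro x hx c
      rw [mul_neg, hx, neg_zero]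
    · intro b x hx c
      rw [← mul_assoc, mul_assoc a, hx]
    · intro x b hx c
      rw [← mul_assoc, hx, zero_mul]
  have h3 : star (a * star a) * (a * star a) = 0 := by
    rw [star_mul, star_star, ← mul_assoc, mul_assoc a, h2]
  rw [CStarRing.star_mul_self_eq_zero_iff, CStarRing.mul_star_self_eq_zero_iff] at h3
  exact h3

/-- The image under `f` of the ideal generated by `P_{v₀}` is closed, because injective
`*`-homomorphisms are isometric. -/
theorem isClosed_tensorMap_image [Finite E] (h : G.IsTrimmable v₀ e₀) :
    IsClosed (h.tensorMap '' (vertexIdeal G v₀).toNonUnitalStarSubalgebra) := by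
  let J := (vertexIdeal G v₀).toNonUnitalStarSubalgebra
  let ψ : J →⋆ₙₐ[ℂ] CircleTensor (G.removeEdge e₀).CStar :=
    h.tensorMap.comp (NonUnitalStarSubalgebraClass.subtype J)
  have hψ : Function.Injective ψ := by
    rw [injective_iff_map_eq_zero]
    exact fun a ha => Subtype.ext (h.eq_zero_of_tensorMap_eq_zero a.2 ha)
  have := (NonUnitalStarAlgHom.isometry ψ hψ).isClosedEmbedding.isClosed_range
  rwa [NonUnitalStarAlgHom.coe_comp, Set.range_comp, NonUnitalStarSubalgebraClass.coe_subtype,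
    Subtype.range_coe] at this

/-- All elementary tensors `x ⊗ g` with `x` in the ideal of `C*(G')` generated by `P_{v₀}` are in
the image of the ideal of `C*(G)` generated by `P_{v₀}`: the elements `x` with this property form a
closed ideal, since `S_e x ⊗ g = f(S_e) (x ⊗ u* g)` and `S_e* x ⊗ g = f(S_e)* (x ⊗ u g)`, and the
ideal contains `P_{v₀}`, since `P_{v₀} ⊗ u g = f(S_{e₀}) (P_{v₀} ⊗ g)`. -/
theorem elemTensor_mem_tensorMap_image [Finite E] (h : G.IsTrimmable v₀ e₀)
    {x : (G.removeEdge e₀).CStar}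
    (hx : x ∈ (vertexIdeal (G.removeEdge e₀) v₀).toNonUnitalStarSubalgebra) (g : C(Circle, ℂ)) :
    elemTensor x g ∈ h.tensorMap '' (vertexIdeal G v₀).toNonUnitalStarSubalgebra := by
  set F' := CStar.family (G.removeEdge e₀) with hF'
  have hcl := h.isClosed_tensorMap_image
  set J := (vertexIdeal G v₀).toNonUnitalStarSubalgebra with hJ
  let T := J.map h.tensorMap
  have hT : (T : Set (CircleTensor (G.removeEdge e₀).CStar)) = h.tensorMap '' J := rfl
  rw [← hT] at hcl ⊢
  have hTl : ∀ a, ∀ y ∈ T, h.tensorMap a * y ∈ T := by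
    rintro a _ ⟨y, hy, rfl⟩
    exact ⟨a * y, (vertexIdeal G v₀).mul_mem_left a hy, map_mul _ _ _⟩
  have hfP : ∀ v, h.tensorMap ((CStar.family G).P v) = elemTensor (F'.P v) 1 := fun v =>
    CStar.lift_P _ _
  have hfS : ∀ e : {e // e ≠ e₀}, h.tensorMap ((CStar.family G).S e) =
      elemTensor (F'.S e) circleU := fun e => (CStar.lift_S _ _).trans (h.tensorFamily_S e)
  have hfS₀ : h.tensorMap ((CStar.family G).S e₀) = elemTensor (F'.P v₀) circleU :=
    (CStar.lift_S _ _).trans h.tensorFamily_S_loop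
  have hpp := (F'.isStarProjection v₀).isIdempotentElem.eq
  have hps := (F'.isStarProjection v₀).isSelfAdjoint.star_eq
  let X : Submodule ℂ (G.removeEdge e₀).CStar :=
    { carrier := {x | ∀ g, elemTensor x g ∈ T}
      zero_mem' := fun g => by
        rw [CircleTensor.zero_elemTensor]
        exact zero_mem T
      add_mem' := fun ha hb g => by
        rw [CircleTensor.add_elemTensor]
        exact add_mem (ha g) (hb g)
      smul_mem' := fun c a ha g => by
        rw [CircleTensor.smul_elemTensor]
        exact SMulMemClass.smul_mem c (ha g) }
  have hX : IsClosed (X : Set (G.removeEdge e₀).CStar) := by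
    have : (X : Set (G.removeEdge e₀).CStar) = ⋂ g, {x | elemTensor x g ∈ T} := by
      ext x
      simp only [Set.mem_iInter]
      rfl
    rw [this]
    exact isClosed_iInter fun g => hcl.preimage (CircleTensor.continuous_elemTensor_left g)
  have hXl : ∀ a, ∀ x ∈ X, a * x ∈ X := fun a x hx => by
    refine CStar.mul_mem_of_isClosed hX (fun v x hx g => ?_) (fun e x hx g => ?_)
      (fun e x hx g => ?_) a hx
    · have := hTl ((CStar.family G).P v) _ (hx g)
      rwa [hfP, CircleTensor.elemTensor_mul, one_mul] at this
    · have := hTl ((CStar.family G).S e) _ (hx (star circleU * g))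
      rwa [hfS, CircleTensor.elemTensor_mul, ← mul_assoc, CircleTensor.circleU_mul_star,
        one_mul] at this
    · have := hTl (star ((CStar.family G).S e)) _ (hx (circleU * g))
      rwa [map_star, hfS, CircleTensor.star_elemTensor, CircleTensor.elemTensor_mul, ← mul_assoc,
        CircleTensor.star_circleU_mul, one_mul] at this
  have hXs : ∀ x ∈ X, star x ∈ X := fun x hx g => by
    have := star_mem (hx (star g))
    rwa [CircleTensor.star_elemTensor, star_star] at this
  have hXp : F'.P v₀ ∈ X := by
    let Y : Submodule ℂ C(Circle, ℂ) :=
      { carrier := {g | elemTensor (F'.P v₀) g ∈ T}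
        zero_mem' := by
          change _ ∈ T
          rw [CircleTensor.elemTensor_zero]
          exact zero_mem T
        add_mem' := fun {a b} (ha : _ ∈ T) (hb : _ ∈ T) => by
          change _ ∈ T
          rw [CircleTensor.elemTensor_add]
          exact add_mem ha hb
        smul_mem' := fun c a (ha : _ ∈ T) => by
          change _ ∈ T
          rw [CircleTensor.elemTensor_smul]
          exact SMulMemClass.smul_mem c ha }
    refine mem_of_circleU_mul_mem (X := Y)
      (hcl.preimage (CircleTensor.continuous_elemTensor_right _)) ?_ (fun g (hg : _ ∈ T) => ?_)
      (fun g (hg : _ ∈ T) => ?_)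
    · exact ⟨_, ClosedStarIdeal.self_mem_ofProjection _, hfP v₀⟩
    · have := hTl ((CStar.family G).S e₀) _ hg
      rwa [hfS₀, CircleTensor.elemTensor_mul, hpp] at this
    · have := hTl (star ((CStar.family G).S e₀)) _ hg
      rwa [map_star, hfS₀, CircleTensor.star_elemTensor, hps, CircleTensor.elemTensor_mul,
        hpp] at this
  exact ClosedStarIdeal.ofProjection_subset (F'.isStarProjection v₀) (N := X) hX hXp X.zero_mem
    X.add_mem X.neg_mem (hXl _ _) (fun {x b} hx => by
      simpa using hXs _ (hXl (star b) _ (hXs x hx))) hx g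

/-- The kernel of `π₂ ⊗ id` is contained in the image under `f` of the kernel of `π₁`. -/
theorem exists_tensorMap_eq_of_tensorId_eq_zero [Finite E] (h : G.IsTrimmable v₀ e₀)
    {c : CircleTensor (G.removeEdge e₀).CStar} (hc : tensorId h.quotientMap' c = 0) :
    ∃ a, h.quotientMap a = 0 ∧ h.tensorMap a = c := by
  let J' := (vertexIdeal (G.removeEdge e₀) v₀).toNonUnitalStarSubalgebra
  have hker : ∀ z, c z ∈ J' := fun z =>
    h.isQuotientByIdeal_quotientMap'.ker_eq.subset
      (congrArg (fun d : CircleTensor (G.removeVertex v₀).CStar => d z) hc)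
  let c' : C(Circle, J') := ⟨fun z => ⟨c z, hker z⟩, by fun_prop⟩
  let T := ((vertexIdeal G v₀).toNonUnitalStarSubalgebra).map h.tensorMap
  -- elementary tensors are dense in the continuous functions with values in the ideal
  have hT : ∀ d : C(Circle, J'), tensorId (NonUnitalStarSubalgebraClass.subtype J') d ∈ T := by
    intro d
    have hcl : IsClosed {d : C(Circle, J') |
        tensorId (NonUnitalStarSubalgebraClass.subtype J') d ∈ T} :=
      h.isClosed_tensorMap_image.preimage (CStar.continuous_hom _)
    refine hcl.closure_subset_iff.mpr ?_ (CircleTensor.denseRange_ofAlgebraic (A := J') d)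
    rintro _ ⟨t, rfl⟩
    change _ ∈ T
    induction t using TensorProduct.induction_on with
    | zero => simp
    | add x y hx hy => rw [map_add, map_add]; exact add_mem hx hy
    | tmul x g =>
      rw [CircleTensor.ofAlgebraic_tmul, CircleTensor.tensorId_elemTensor]
      exact h.elemTensor_mem_tensorMap_image x.2 g
  obtain ⟨a, ha, hac⟩ := hT c'
  exact ⟨a, h.isQuotientByIdeal_quotientMap.ker_eq.superset ha, hac⟩

theorem existsUnique_of_gaugeCoaction_eq [Finite E] (h : G.IsTrimmable v₀ e₀)
    (b : (G.removeVertex v₀).CStar) (c : CircleTensor (G.removeEdge e₀).CStar)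
    (hbc : (G.removeVertex v₀).gaugeCoaction b = tensorId h.quotientMap' c) :
    ∃! a, h.quotientMap a = b ∧ h.tensorMap a = c := by
  obtain ⟨a₁, rfl⟩ := h.isQuotientByIdeal_quotientMap.surjective b
  obtain ⟨a₂, ha₂, hfa₂⟩ := h.exists_tensorMap_eq_of_tensorId_eq_zero
    (c := c - h.tensorMap a₁) (by rw [map_sub, ← hbc, h.quotientMap_tensorMap_comm, sub_self])
  refine ⟨a₁ + a₂, ⟨by rw [map_add, ha₂, add_zero], by rw [map_add, hfa₂, add_sub_cancel]⟩, ?_⟩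
  rintro a ⟨ha, hfa⟩
  rw [← sub_eq_zero]
  refine h.eq_zero_of_tensorMap_eq_zero ?_ (by rw [map_sub, map_add, hfa, hfa₂]; abel)
  refine h.isQuotientByIdeal_quotientMap.ker_eq.subset ?_
  change h.quotientMap _ = 0
  rw [map_sub, map_add, ha, ha₂, add_zero, sub_self]

end IsTrimmable

end DirectedGraph

end

theorem mainTheorem1 {V E : Type*} [Finite V] [Finite E] (G : DirectedGraph V E)
    (v₀ : V) (e₀ : E) (h : G.IsTrimmable v₀ e₀) :
    IsQuotientByIdeal h.quotientMap ((DirectedGraph.CStar.family G).P v₀) ∧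
    IsQuotientByIdeal h.quotientMap' ((DirectedGraph.CStar.family (G.removeEdge e₀)).P v₀) ∧
    IsEquivariantPullback
      G.gaugeAction
      (G.removeVertex v₀).gaugeAction
      (rotationAction (G.removeEdge e₀).CStar)
      (rotationAction (G.removeVertex v₀).CStar)
      h.quotientMap
      h.tensorMap
      (G.removeVertex v₀).gaugeCoaction
      (tensorId h.quotientMap') :=
  ⟨h.isQuotientByIdeal_quotientMap, h.isQuotientByIdeal_quotientMap',
    { equivariant_p₁ := h.isEquivariant_quotientMap
      equivariant_p₂ := h.isEquivariant_tensorMap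
      equivariant_q₁ := DirectedGraph.isEquivariant_gaugeCoaction _
      equivariant_q₂ := isEquivariant_tensorId _
      comm := h.quotientMap_tensorMap_comm
      existsUnique := h.existsUnique_of_gaugeCoaction_eq }⟩
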